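/- **Setting.** Let $n\ge 2$, $T\ge 1$. Let $\mathcal G_0$ be a connected simple graph on the nodes $[n]=\{1,\dots,n\}$ and let $\mathcal G_1,\mathcal G_2,\dots,\mathcal G_T$ be obtained by adding at most one edge per step: the Laplacians satisfy $L_t=L_{t-1}+u_t\,a_{l_t}a_{l_t}^T$ with $u_t\in\{0,1\}$, where, if $u_t=1$, $l_t$ is an edge not in $\mathcal G_{t-1}$; $a_l=e_i-e_j$ is the edge vector of $l\sim(i,j)$, and $u_t=0$ for $t>T$. Let $\delta_{\max}$ be the maximum degree of $\mathcal G_0,\dots,\mathcal G_T$ and $P_t=I-\frac{1}{2(1+\delta_{\max})}L_t$. Write $\lambda_1\ge\dots\ge\lambda_n$ for eigenvalues, $\sigma_2$ for the second largest singular value, $\sigma=\sigma_2(P_0)$, and let $v_t$ be a unit eigenvector of $L_t$ for $\lambda_{n-1}(L_t)$. Put $b_t^{-1}=2(1+\delta_{\max})+\frac{12(1+\delta_{\max})}{\lambda_{n-2}(L_t)-\lambda_{n-1}(L_t)}$, with $b_t=0$ if $\lambda_{n-2}(L_t)=\lambda_{n-1}(L_t)$. Let $\delta^*$ be the optimal value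 of the problem: minimize $\delta$ over $\beta>0$ and integers $\delta\ge1$ subject to $$\log\beta=\sum_{k=1}^{\delta-1}\log\Bigl(1-\frac{\sum_{i=1}^k u_i b_{i-1}(a_{l_i}^Tv_{i-1})^2}{\sigma}\Bigr),\qquad \delta\ \ge\ \frac{\log (T\sqrt n)}{\log\sigma^{-1}}-\frac{\log\beta^{-1}}{\log\sigma^{-1}} .$$ Let $\|\cdot\|$ be a norm on $\mathbb R^p$ with dual norm $\|\cdot\|_*$, $\mathcal X\subseteq\mathbb R^p$ a closed convex set containing $0$, and $f_1,\dots,f_n$ functions that are convex and $L$-Lipschitz on $\mathcal X$ with respect to $\|\cdot\|$ ($L>0$). Let $f=\frac1n\sum_i f_i$, let $x^*$ minimize $f$ over $\mathcal X$, and let $\psi\ge0$ with $\psi(0)=0$ be $1$-strongly convex on $\mathcal X$ with respect to $\|\cdot\|$, with $\psi(x^*)\le R^2$, $R>0$. Distributed dual averaging (DDA) starts from $z_i(0)=0$ and any $x_i(0)\in\mathcal X$ and iterates $$z_i(t+1)=\sum_{j}[P_t]_{ji}z_j(t)+g_i(t),\qquad x_i(t+1)\in\operatorname*{arg\,min}_{x\in\mathcal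 X}\Bigl\{z_i(t+1)^Tx+\tfrac1{\alpha_t}\psi(x)\Bigr\},$$ where $g_i(t)$ is a subgradient of $f_i$ on $\mathcal X$ at $x_i(t)$ with $\|g_i(t)\|_*\le L$. The step sizes are $\alpha_t=c\,R\sqrt{1-\sigma}/(L\sqrt t)$ for $t\ge1$, and $\alpha_0=\alpha_1$, where $c>0$ is a fixed constant. Let $\hat x_i(T)=\frac1T\sum_{t=1}^Tx_i(t)$. **Theorem 2.** The optimal value $\delta^*$ is attained, $1\le\delta^*\le\bigl\lceil \log(T\sqrt n)/\log\sigma^{-1}\bigr\rceil$, and for every agent $i\in[n]$ $$f(\hat x_i(T))-f(x^*)=\mathcal O\Bigl(\frac{RL\sqrt{1-\sigma_2(P_0)}\;\delta^*}{\sqrt T}\Bigr)$$ in the following sense. There are a number $C$ that depends only on $c$, and numbers $T_0(\sigma)$, $K(\sigma)$ that depend only on $c$ and $\sigma=\sigma_2(P_0)$, such that the left side is at most $C\,RL\sqrt{1-\sigma}\,\delta^*/\sqrt T$ whenever $T\ge T_0(\sigma)$, and at most $K(\sigma)\,RL\sqrt{1-\sigma}\,\delta^*/\sqrt T$ for every $T\ge1$.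 -/

import Mathlib

open scoped Classical in
/-- The Laplacian matrix `D - A` of a graph on `n` nodes, over `ℝ`. -/
noncomputable def lap {n : ℕ} (G : SimpleGraph (Fin n)) : Matrix (Fin n) (Fin n) ℝ :=
  G.lapMatrix ℝ

theorem lap_isHermitian {n : ℕ} (G : SimpleGraph (Fin n)) : (lap G).IsHermitian := by
  classical
  unfold lap
  exact SimpleGraph.isHermitian_lapMatrix ℝ G

/-- `lamLap G k` is `λ_k`, the `k`-th largest eigenvalue (`1 ≤ k ≤ n`, with multiplicity) of the
Laplacian of `G`; thus `lamLap G (n - 1)` is the algebraic connectivity. -/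
noncomputable def lamLap {n : ℕ} (G : SimpleGraph (Fin n)) (k : ℕ) : ℝ :=
  if h : 1 ≤ k ∧ k ≤ n then
    (lap_isHermitian G).eigenvalues₀ ⟨k - 1, by rw [Fintype.card_fin]; omega⟩
  else 0

/-- The second largest singular value of a square matrix (Mathlib counts from `0`). -/
noncomputable def sigma2 {n : ℕ} (P : Matrix (Fin n) (Fin n) ℝ) : ℝ :=
  (Matrix.toEuclideanLin P).singularValues 1

/-- The edge vector `e_i - e_j` of an edge with end nodes `i` and `j`. -/
def edgeVec {n : ℕ} (e : Fin n × Fin n) : Fin n → ℝ :=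
  Pi.single e.1 1 - Pi.single e.2 1

/-- A network on `n` nodes over the time horizon `T`, which starts from a connected graph `G 0` and
grows by at most one edge per time step: `L_t = L_{t-1} + u_t a_{l_t} a_{l_t}ᵀ`, where `u_t = 1` if
an edge is added at time `t` and `u_t = 0` otherwise, and an added edge `l_t` is not in `G (t - 1)`.
No edge is added after time `T`. -/
structure EvolvingNetwork (n T : ℕ) where
  /-- the graph at time `t` -/
  G : ℕ → SimpleGraph (Fin n)
  /-- the edge schedule -/
  u : ℕ → ℝ
  /-- the edge added at time `t` if `u t = 1` (irrelevant otherwise) -/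
  l : ℕ → Fin n × Fin n
  connected : (G 0).Connected
  u_binary : ∀ t, u t = 0 ∨ u t = 1
  l_new : ∀ t, 1 ≤ t → u t = 1 → (l t).1 ≠ (l t).2 ∧ ¬ (G (t - 1)).Adj (l t).1 (l t).2
  step : ∀ t, 1 ≤ t →
    lap (G t) = lap (G (t - 1)) + u t • Matrix.vecMulVec (edgeVec (l t)) (edgeVec (l t))
  u_after : ∀ t, T < t → u t = 0

namespace EvolvingNetwork

variable {n T : ℕ}

open scoped Classical in
/-- The maximum degree of the graphs `G 0, …, G T`. -/
noncomputable def degMax (N : EvolvingNetwork n T) : ℕ :=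
  (Finset.range (T + 1)).sup fun t => (N.G t).maxDegree

/-- The weight matrix `P_t = I - L_t / (2 (1 + δ_max))`. -/
noncomputable def P (N : EvolvingNetwork n T) (t : ℕ) : Matrix (Fin n) (Fin n) ℝ :=
  1 - (1 / (2 * (1 + (N.degMax : ℝ)))) • lap (N.G t)

/-- `v` is a choice, at each time, of a unit eigenvector of `L_t` for the eigenvalue
`λ_{n-1}(L_t)`. -/
def IsConnectivityEigenvector (N : EvolvingNetwork n T) (v : ℕ → Fin n → ℝ) : Prop :=
  ∀ t ≤ T, v t ⬝ᵥ v t = 1 ∧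
    Matrix.mulVec (lap (N.G t)) (v t) = lamLap (N.G t) (n - 1) • v t

/-- The spectral gap `λ_{n-2}(L_t) - λ_{n-1}(L_t)`. -/
noncomputable def gap (N : EvolvingNetwork n T) (t : ℕ) : ℝ :=
  lamLap (N.G t) (n - 2) - lamLap (N.G t) (n - 1)

/-- The coefficient `b_t`, with
`b_t⁻¹ = 2 (1 + δ_max) + 12 (1 + δ_max) / (λ_{n-2}(L_t) - λ_{n-1}(L_t))`;
if the gap vanishes, then `b_t⁻¹ = ∞` and `b_t = 0`. -/
noncomputable def b (N : EvolvingNetwork n T) (t : ℕ) : ℝ :=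
  if N.gap t = 0 then 0
  else (2 * (1 + (N.degMax : ℝ)) + 12 * (1 + (N.degMax : ℝ)) / N.gap t)⁻¹

/-- The guaranteed decrease `∑_{i=1}^k u_i b_{i-1} (a_{l_i}ᵀ v_{i-1})²` of `σ₂` up to time `k`. -/
noncomputable def decrease (N : EvolvingNetwork n T) (v : ℕ → Fin n → ℝ) (k : ℕ) : ℝ :=
  ∑ i ∈ Finset.Icc 1 k, N.u i * N.b (i - 1) * (edgeVec (N.l i) ⬝ᵥ v (i - 1)) ^ 2

/-- The pairs `(β, δ)` that are feasible for the mixing time problem "minimize `δ`". -/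
def Feasible (N : EvolvingNetwork n T) (v : ℕ → Fin n → ℝ) (β : ℝ) (δ : ℕ) : Prop :=
  0 < β ∧ 1 ≤ δ ∧
  Real.log β = ∑ k ∈ Finset.Icc 1 (δ - 1), Real.log (1 - N.decrease v k / sigma2 (N.P 0)) ∧
  (δ : ℝ) ≥ Real.log (T * √n) / Real.log (sigma2 (N.P 0))⁻¹
    - Real.log β⁻¹ / Real.log (sigma2 (N.P 0))⁻¹

/-- `δ` is the optimal value of the mixing time problem. -/
def IsMixingTime (N : EvolvingNetwork n T) (v : ℕ → Fin n → ℝ) (δ : ℕ) : Prop :=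
  IsLeast {d : ℕ | ∃ β : ℝ, N.Feasible v β d} δ

end EvolvingNetwork

section DDA

variable {E : Type*} [NormedAddCommGroup E] [NormedSpace ℝ E] {n : ℕ}

/-- The network cost `(1/n) ∑ f_i`. -/
noncomputable def networkCost (f : Fin n → E → ℝ) (x : E) : ℝ :=
  (1 / (n : ℝ)) * ∑ i, f i x

/-- A distributed convex problem with its proximal function: a closed convex set `X` containing the
origin, local costs `f_i` that are convex and `L`-Lipschitz on `X`, and a function `ψ ≥ 0` with
`ψ 0 = 0` that is `1`-strongly convex on `X`, all with respect to the norm of `E`. -/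
structure IsDistributedProblem (X : Set E) (f : Fin n → E → ℝ) (L : ℝ) (ψ : E → ℝ) : Prop where
  isClosed : IsClosed X
  convex : Convex ℝ X
  zero_mem : (0 : E) ∈ X
  f_convex : ∀ i, ConvexOn ℝ X (f i)
  f_lipschitz : ∀ i, ∀ x ∈ X, ∀ y ∈ X, |f i x - f i y| ≤ L * ‖x - y‖
  ψ_strongConvex : StrongConvexOn X 1 ψ
  ψ_nonneg : ∀ x ∈ X, 0 ≤ ψ x
  ψ_zero : ψ 0 = 0

/-- `x_i(t)`, `z_i(t)`, `g_i(t)` are produced by distributed dual averaging with weight matrices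
`P_t` and step sizes `α_t` over the time horizon `T`, started from `z_i(0) = 0` and any
`x_i(0) ∈ X`. The dual variables and the subgradients live in the dual space, with the dual norm;
`g_i(t)` is a subgradient at `x_i(t)` of the `L`-Lipschitz function `f_i` on `X`, of dual norm at
most `L`, as are all subgradients of an `L`-Lipschitz function on the whole space. -/
structure IsDDARun (P : ℕ → Matrix (Fin n) (Fin n) ℝ) (X : Set E) (f : Fin n → E → ℝ) (L : ℝ)
    (ψ : E → ℝ) (α : ℕ → ℝ) (T : ℕ) (x : ℕ → Fin n → E) (z g : ℕ → Fin n → StrongDual ℝ E) :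
    Prop where
  z_zero : ∀ i, z 0 i = 0
  x_zero : ∀ i, x 0 i ∈ X
  subgradient : ∀ t ≤ T, ∀ i, ∀ y ∈ X, f i (x t i) + g t i (y - x t i) ≤ f i y
  subgradient_norm : ∀ t ≤ T, ∀ i, ‖g t i‖ ≤ L
  z_step : ∀ t < T, ∀ i, z (t + 1) i = (∑ j, P t j i • z t j) + g t i
  x_mem : ∀ t < T, ∀ i, x (t + 1) i ∈ X
  x_step : ∀ t < T, ∀ i, IsMinOn (fun y => z (t + 1) i y + 1 / α t * ψ y) X (x (t + 1) i)

/-- The running local average `(1/T) ∑_{t=1}^T x_i(t)`. -/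
noncomputable def runningAverage (x : ℕ → Fin n → E) (T : ℕ) (i : Fin n) : E :=
  (1 / (T : ℝ)) • ∑ t ∈ Finset.Icc 1 T, x t i

end DDA

/-!
On the vectors of sum zero, the quadratic form of the Laplacian is at least `λ_{n-1}`, so `P_t`
contracts them by the factor `1 - λ_{n-1}(L_t) / (2 (1 + δ_max))`, which lies in `[1/2, 1)` and
equals `σ₂(P_t)`. A new edge raises `λ_{n-1}`: split a vector along `v_t` and its complement, where
the form of `L_t` is at least `λ_{n-2}(L_t)`. The feasibility of `δ` for the mixing time problem
then says precisely that the resulting bound on the contraction over `δ` steps is at most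
`1 / (T √n)`. Inputs older than `δ` are therefore spread evenly over the nodes up to `1 / T`, the
fresh ones cost at most `2` each, and every `z_i(t)` stays within `(2 δ + 1) L` of the accumulated
average input.

Up to this error, each node runs dual averaging on the accumulated average input. The minimum of the
regularized objective decreases by a controlled amount per step, and the primal points of the nodes
differ by `O(α_t δ L)`, as the proximal map is Lipschitz. The regret is thus at most
`R L / √T * O(1 / q + q δ)` with `q = √(1 - σ)`. This is of order `R L q δ / √T`, with a constant
depending only on `c`, once `1 / q² ≤ δ`, which holds for large `T`: all contraction factors are at
least `1/2`, so `T ≤ 2 ^ δ`.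
-/

section MinMax

open Module

variable {E F : Type*} [NormedAddCommGroup E] [InnerProductSpace ℝ E] [NormedAddCommGroup F]
  [InnerProductSpace ℝ F]

theorem exists_mem_ne_zero_forall_inner_eq_zero {ι : Type*} [Finite ι] (b : ι → E)
    (W : Submodule ℝ E) [FiniteDimensional ℝ W] (hW : Nat.card ι < finrank ℝ W) :
    ∃ w ∈ W, w ≠ 0 ∧ ∀ j, inner ℝ (b j) w = 0 := by
  have := Fintype.ofFinite ι
  let coords : W →ₗ[ℝ] ι → ℝ := LinearMap.pi fun j => innerₛₗ ℝ (b j) ∘ₗ W.subtype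
  have hker : LinearMap.ker coords ≠ ⊥ :=
    LinearMap.ker_ne_bot_of_finrank_lt <| by simpa [Nat.card_eq_fintype_card] using hW
  obtain ⟨w, hw, hw0⟩ := (Submodule.ne_bot_iff _).1 hker
  exact ⟨w, w.2, fun h => hw0 (Subtype.ext h), congrFun (LinearMap.mem_ker.1 hw)⟩

variable [FiniteDimensional ℝ E] {A : E →ₗ[ℝ] E} (hA : A.IsSymmetric) {n : ℕ}
  (hn : finrank ℝ E = n)

theorem inner_apply_self_eq_sum_eigenvalues (w : E) :
    inner ℝ (A w) w = ∑ j, hA.eigenvalues hn j * inner ℝ (hA.eigenvectorBasis hn j) w ^ 2 := by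
  rw [← (hA.eigenvectorBasis hn).sum_inner_mul_inner]
  refine Finset.sum_congr rfl fun j _ => ?_
  rw [real_inner_comm, ← hA, hA.apply_eigenvectorBasis, real_inner_smul_left]
  simp only [RCLike.ofReal_real_eq_id, id_eq]
  ring

theorem exists_mem_inner_apply_self_le_eigenvalues (i : Fin n) (W : Submodule ℝ E)
    (hW : i < finrank ℝ W) :
    ∃ w ∈ W, w ≠ 0 ∧ inner ℝ (A w) w ≤ hA.eigenvalues hn i * ‖w‖ ^ 2 := by
  obtain ⟨w, hw, hw0, hort⟩ := exists_mem_ne_zero_forall_inner_eq_zero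
    (fun j : Set.Iio i => hA.eigenvectorBasis hn j) W (by simpa using hW)
  refine ⟨w, hw, hw0, ?_⟩
  rw [inner_apply_self_eq_sum_eigenvalues hA hn, ← (hA.eigenvectorBasis hn).sum_sq_inner_right,
    Finset.mul_sum]
  refine Finset.sum_le_sum fun j _ => ?_
  rcases lt_or_ge j i with hij | hij
  · simp [hort ⟨j, hij⟩]
  · gcongr
    exact hA.eigenvalues_antitone hn hij

theorem exists_mem_eigenvalues_mul_le_inner_apply_self (i : Fin n) (W : Submodule ℝ E)
    (hW : n ≤ i + finrank ℝ W) :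
    ∃ w ∈ W, w ≠ 0 ∧ hA.eigenvalues hn i * ‖w‖ ^ 2 ≤ inner ℝ (A w) w := by
  obtain ⟨w, hw, hw0, hort⟩ := exists_mem_ne_zero_forall_inner_eq_zero
    (fun j : Set.Ioi i => hA.eigenvectorBasis hn j) W (by simp; omega)
  refine ⟨w, hw, hw0, ?_⟩
  rw [inner_apply_self_eq_sum_eigenvalues hA hn, ← (hA.eigenvectorBasis hn).sum_sq_inner_right,
    Finset.mul_sum]
  refine Finset.sum_le_sum fun j _ => ?_
  rcases lt_or_ge i j with hij | hij
  · simp [hort ⟨j, hij⟩]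
  · gcongr
    exact hA.eigenvalues_antitone hn hij

variable [FiniteDimensional ℝ F] (S : E →ₗ[ℝ] F)

theorem singularValues_le_of_submodule {i : ℕ} (hi : i < finrank ℝ E) {s : ℝ} (hs : 0 ≤ s)
    (W : Submodule ℝ E) (hW : finrank ℝ E ≤ i + finrank ℝ W)
    (h : ∀ w ∈ W, ‖S w‖ ^ 2 ≤ s ^ 2 * ‖w‖ ^ 2) : S.singularValues i ≤ s := by
  obtain ⟨w, hw, hw0, hle⟩ := exists_mem_eigenvalues_mul_le_inner_apply_self
    S.isSymmetric_adjoint_comp_self rfl ⟨i, hi⟩ W hW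
  rw [← S.sq_singularValues_of_lt rfl hi, LinearMap.comp_apply, LinearMap.adjoint_inner_left,
    real_inner_self_eq_norm_sq] at hle
  exact le_of_sq_le_sq (le_of_mul_le_mul_right (hle.trans (h w hw)) (by positivity)) hs

theorem le_singularValues_of_submodule {i : ℕ} {s : ℝ}
    (W : Submodule ℝ E) (hW : i < finrank ℝ W)
    (h : ∀ w ∈ W, s ^ 2 * ‖w‖ ^ 2 ≤ ‖S w‖ ^ 2) : s ≤ S.singularValues i := by
  have hi : i < finrank ℝ E := hW.trans_le W.finrank_le
  obtain ⟨w, hw, hw0, hle⟩ := exists_mem_inner_apply_self_le_eigenvalues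
    S.isSymmetric_adjoint_comp_self rfl ⟨i, hi⟩ W hW
  rw [← S.sq_singularValues_of_lt rfl hi, LinearMap.comp_apply, LinearMap.adjoint_inner_left,
    real_inner_self_eq_norm_sq] at hle
  exact le_of_sq_le_sq (le_of_mul_le_mul_right ((h w hw).trans hle) (by positivity))
    (S.singularValues_nonneg i)

end MinMax

section QuadraticForm

open Matrix Module

variable {ι : Type*} [Fintype ι] {A : Matrix ι ι ℝ}

theorem dotProduct_mulVec_comm (hA : A.IsHermitian) (x y : ι → ℝ) :
    x ⬝ᵥ A *ᵥ y = y ⬝ᵥ A *ᵥ x := by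
  rw [dotProduct_mulVec, ← mulVec_transpose, ← conjTranspose_eq_transpose_of_trivial, hA,
    dotProduct_comm]

theorem dotProduct_sq_le (x y : ι → ℝ) : (x ⬝ᵥ y) ^ 2 ≤ (x ⬝ᵥ x) * (y ⬝ᵥ y) := by
  simpa only [dotProduct, sq] using Finset.sum_mul_sq_le_sq_mul_sq Finset.univ x y

theorem dotProduct_self_pos {w : ι → ℝ} (hw : w ≠ 0) : 0 < w ⬝ᵥ w := by
  simpa using dotProduct_self_star_pos_iff.2 hw

/-- The vectors whose coordinates sum to zero: the orthogonal complement of the constants, on which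
a network of averaging agents contracts. -/
def sumZero (ι : Type*) [Fintype ι] : Submodule ℝ (ι → ℝ) :=
  LinearMap.ker (dotProductBilin ℝ ℝ 1)

theorem mem_sumZero {w : ι → ℝ} : w ∈ sumZero ι ↔ 1 ⬝ᵥ w = 0 := by
  simp only [sumZero, LinearMap.mem_ker, dotProductBilin_apply_apply]

theorem finrank_sumZero_add_one [Nonempty ι] : finrank ℝ (sumZero ι) + 1 = Fintype.card ι := by
  rw [← finrank_fintype_fun_eq_card ℝ]
  refine Dual.finrank_ker_add_one_of_ne_zero fun h => ?_
  simpa using congrArg (fun φ => φ 1) h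

theorem linearIndependent_of_pairwise_dotProduct_eq_zero {κ : Type*} (e : κ → ι → ℝ)
    (he0 : ∀ j, e j ≠ 0) (he : Pairwise fun j k => e j ⬝ᵥ e k = 0) : LinearIndependent ℝ e :=
  LinearMap.linearIndependent_of_isOrthoᵢ (B := dotProductBilin ℝ ℝ)
    (LinearMap.isOrthoᵢ_def.2 fun _ _ hjk => he hjk) fun j => (dotProduct_self_pos (he0 j)).ne'

theorem dotProduct_mulVec_self_nonneg_of_mem_span {κ : Type*} [Finite κ] {e : κ → ι → ℝ}
    (he : Pairwise fun j k => e j ⬝ᵥ A *ᵥ e k = 0) (h : ∀ j, 0 ≤ e j ⬝ᵥ A *ᵥ e j) {w : ι → ℝ}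
    (hw : w ∈ Submodule.span ℝ (Set.range e)) : 0 ≤ w ⬝ᵥ A *ᵥ w := by
  have := Fintype.ofFinite κ
  obtain ⟨a, rfl⟩ := (Submodule.mem_span_range_iff_exists_fun ℝ).1 hw
  have hdiag : ∀ j, a j • e j ⬝ᵥ A *ᵥ ∑ k, a k • e k = a j ^ 2 * (e j ⬝ᵥ A *ᵥ e j) := by
    intro j
    rw [mulVec_sum, dotProduct_sum, Finset.sum_eq_single j _ (by simp)]
    · simp only [mulVec_smul, dotProduct_smul, smul_dotProduct, smul_eq_mul]
      ring
    · intro k _ hkj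
      simp only [mulVec_smul, dotProduct_smul, smul_dotProduct, he hkj.symm, smul_zero]
  rw [sum_dotProduct]
  exact Finset.sum_nonneg fun j _ => hdiag j ▸ mul_nonneg (sq_nonneg _) (h j)

theorem norm_sq_toLp (x : ι → ℝ) : ‖WithLp.toLp 2 x‖ ^ 2 = x ⬝ᵥ x := by
  rw [← real_inner_self_eq_norm_sq, EuclideanSpace.inner_toLp_toLp, star_trivial]

theorem mulVec_dotProduct_mulVec_le (hA : A.PosSemidef) {s : ℝ} (hs : 0 < s)
    {W : Submodule ℝ (ι → ℝ)} (hW : ∀ w ∈ W, A *ᵥ w ∈ W)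
    (hle : ∀ w ∈ W, w ⬝ᵥ A *ᵥ w ≤ s * (w ⬝ᵥ w)) {w : ι → ℝ} (hw : w ∈ W) :
    A *ᵥ w ⬝ᵥ A *ᵥ w ≤ s ^ 2 * (w ⬝ᵥ w) := by
  have hform : 0 ≤ s ^ 2 * (w ⬝ᵥ A *ᵥ w) - 2 * s * (A *ᵥ w ⬝ᵥ A *ᵥ w)
      + A *ᵥ w ⬝ᵥ A *ᵥ (A *ᵥ w) := by
    have h := hA.dotProduct_mulVec_nonneg (s • w - A *ᵥ w)
    simp only [star_trivial, mulVec_sub, mulVec_smul, sub_dotProduct, dotProduct_sub,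
      smul_dotProduct, dotProduct_smul, smul_eq_mul,
      dotProduct_mulVec_comm hA.isHermitian w (A *ᵥ w)] at h
    linarith
  have hAw := hle _ (hW w hw)
  have hsw := mul_le_mul_of_nonneg_left (hle w hw) (sq_nonneg s)
  refine le_of_mul_le_mul_left ?_ hs
  linarith

variable [DecidableEq ι]

theorem exists_mem_dotProduct_mulVec_self_le_eigenvalues₀ (hA : A.IsHermitian)
    (i : Fin (Fintype.card ι)) (W : Submodule ℝ (ι → ℝ)) (hW : i < finrank ℝ W) :
    ∃ w ∈ W, w ≠ 0 ∧ w ⬝ᵥ A *ᵥ w ≤ hA.eigenvalues₀ i * (w ⬝ᵥ w) := by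
  obtain ⟨_, ⟨w, hw, rfl⟩, hw0, hle⟩ := exists_mem_inner_apply_self_le_eigenvalues
    (isSymmetric_toEuclideanLin_iff.2 hA) finrank_euclideanSpace i
    (W.map (WithLp.linearEquiv 2 ℝ (ι → ℝ)).symm.toLinearMap) (by rwa [LinearEquiv.finrank_map_eq])
  refine ⟨w, hw, by simpa using hw0, ?_⟩
  simpa [Matrix.IsHermitian.eigenvalues₀, norm_sq_toLp, EuclideanSpace.inner_toLp_toLp] using hle

theorem exists_mem_eigenvalues₀_mul_le_dotProduct_mulVec_self (hA : A.IsHermitian)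
    (i : Fin (Fintype.card ι)) (W : Submodule ℝ (ι → ℝ))
    (hW : Fintype.card ι ≤ i + finrank ℝ W) :
    ∃ w ∈ W, w ≠ 0 ∧ hA.eigenvalues₀ i * (w ⬝ᵥ w) ≤ w ⬝ᵥ A *ᵥ w := by
  obtain ⟨_, ⟨w, hw, rfl⟩, hw0, hle⟩ := exists_mem_eigenvalues_mul_le_inner_apply_self
    (isSymmetric_toEuclideanLin_iff.2 hA) finrank_euclideanSpace i
    (W.map (WithLp.linearEquiv 2 ℝ (ι → ℝ)).symm.toLinearMap) (by rwa [LinearEquiv.finrank_map_eq])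
  refine ⟨w, hw, by simpa using hw0, ?_⟩
  simpa [Matrix.IsHermitian.eigenvalues₀, norm_sq_toLp, EuclideanSpace.inner_toLp_toLp] using hle

theorem eigenvalues₀_le_of_orthogonal_family (hA : A.IsHermitian) (i : Fin (Fintype.card ι))
    {κ : Type*} [Fintype κ] (e : κ → ι → ℝ) (he0 : ∀ j, e j ≠ 0)
    (he : Pairwise fun j k => e j ⬝ᵥ e k = 0) (hAe : Pairwise fun j k => e j ⬝ᵥ A *ᵥ e k = 0)
    (hκ : Fintype.card ι ≤ i + Fintype.card κ) {c : ℝ}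
    (h : ∀ j, e j ⬝ᵥ A *ᵥ e j ≤ c * (e j ⬝ᵥ e j)) : hA.eigenvalues₀ i ≤ c := by
  have hform : ∀ x y : ι → ℝ, x ⬝ᵥ (c • 1 - A) *ᵥ y = c * (x ⬝ᵥ y) - x ⬝ᵥ A *ᵥ y := fun x y => by
    rw [sub_mulVec, smul_mulVec, one_mulVec, dotProduct_sub, dotProduct_smul, smul_eq_mul]
  have hind := linearIndependent_of_pairwise_dotProduct_eq_zero e he0 he
  obtain ⟨w, hw, hw0, hle⟩ := exists_mem_eigenvalues₀_mul_le_dotProduct_mulVec_self hA i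
    (Submodule.span ℝ (Set.range e)) (by rwa [finrank_span_eq_card hind])
  have hnonneg : 0 ≤ w ⬝ᵥ (c • 1 - A) *ᵥ w := by
    refine dotProduct_mulVec_self_nonneg_of_mem_span (fun j k hjk => ?_) (fun j => ?_) hw
    · simp only [hform, he hjk, hAe hjk, mul_zero, sub_zero]
    · simpa only [hform, sub_nonneg] using h j
  rw [hform, sub_nonneg] at hnonneg
  exact le_of_mul_le_mul_right (hle.trans hnonneg) (dotProduct_self_pos hw0)

variable (P : Matrix ι ι ℝ)

theorem singularValues_toEuclideanLin_le {i : ℕ} (hi : i < Fintype.card ι) {s : ℝ} (hs : 0 ≤ s)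
    (W : Submodule ℝ (ι → ℝ)) (hW : Fintype.card ι ≤ i + finrank ℝ W)
    (h : ∀ w ∈ W, P *ᵥ w ⬝ᵥ P *ᵥ w ≤ s ^ 2 * (w ⬝ᵥ w)) :
    (toEuclideanLin P).singularValues i ≤ s := by
  refine singularValues_le_of_submodule _ (by rwa [finrank_euclideanSpace]) hs
    (W.map (WithLp.linearEquiv 2 ℝ (ι → ℝ)).symm.toLinearMap)
    (by rwa [LinearEquiv.finrank_map_eq, finrank_euclideanSpace]) ?_
  rintro _ ⟨w, hw, rfl⟩
  simpa [norm_sq_toLp] using h w hw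

theorem le_singularValues_toEuclideanLin {i : ℕ} {s : ℝ} (W : Submodule ℝ (ι → ℝ))
    (hW : i < finrank ℝ W) (h : ∀ w ∈ W, s ^ 2 * (w ⬝ᵥ w) ≤ P *ᵥ w ⬝ᵥ P *ᵥ w) :
    s ≤ (toEuclideanLin P).singularValues i := by
  refine le_singularValues_of_submodule _
    (W.map (WithLp.linearEquiv 2 ℝ (ι → ℝ)).symm.toLinearMap)
    (by rwa [LinearEquiv.finrank_map_eq]) ?_
  rintro _ ⟨w, hw, rfl⟩
  simpa [norm_sq_toLp] using h w hw

theorem le_singularValues_toEuclideanLin_of_orthogonal_family {i : ℕ} {s : ℝ} {κ : Type*}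
    [Fintype κ] (e : κ → ι → ℝ) (he0 : ∀ j, e j ≠ 0) (he : Pairwise fun j k => e j ⬝ᵥ e k = 0)
    (hPe : Pairwise fun j k => P *ᵥ e j ⬝ᵥ P *ᵥ e k = 0) (hκ : i < Fintype.card κ)
    (h : ∀ j, s ^ 2 * (e j ⬝ᵥ e j) ≤ P *ᵥ e j ⬝ᵥ P *ᵥ e j) :
    s ≤ (toEuclideanLin P).singularValues i := by
  have hform : ∀ x y : ι → ℝ,
      x ⬝ᵥ (Pᵀ * P - s ^ 2 • 1) *ᵥ y = P *ᵥ x ⬝ᵥ P *ᵥ y - s ^ 2 * (x ⬝ᵥ y) := fun x y => by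
    rw [sub_mulVec, smul_mulVec, one_mulVec, dotProduct_sub, dotProduct_smul, smul_eq_mul,
      ← mulVec_mulVec, dotProduct_mulVec x, vecMul_transpose]
  have hind := linearIndependent_of_pairwise_dotProduct_eq_zero e he0 he
  refine le_singularValues_toEuclideanLin P (Submodule.span ℝ (Set.range e))
    (by rwa [finrank_span_eq_card hind]) fun w hw => ?_
  rw [← sub_nonneg, ← hform]
  refine dotProduct_mulVec_self_nonneg_of_mem_span (fun j k hjk => ?_) (fun j => ?_) hw
  · simp only [hform, he hjk, hPe hjk, mul_zero, sub_zero]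
  · simpa only [hform, sub_nonneg] using h j

end QuadraticForm

section Laplacian

open Matrix

variable {n : ℕ} {G : SimpleGraph (Fin n)}

open scoped Classical in
theorem dotProduct_lap_mulVec_self (w : Fin n → ℝ) :
    w ⬝ᵥ lap G *ᵥ w = (∑ i, ∑ j, if G.Adj i j then (w i - w j) ^ 2 else 0) / 2 := by
  rw [lap, ← toLinearMap₂'_apply', SimpleGraph.lapMatrix_toLinearMap₂']

variable (G) in
theorem posSemidef_lap : (lap G).PosSemidef := by
  classical
  exact G.posSemidef_lapMatrix ℝ

theorem dotProduct_lap_mulVec_self_nonneg (w : Fin n → ℝ) : 0 ≤ w ⬝ᵥ lap G *ᵥ w := by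
  simpa only [star_trivial] using (posSemidef_lap G).dotProduct_mulVec_nonneg w

variable (G) in
theorem lap_mulVec_one : lap G *ᵥ 1 = 0 := by
  classical
  exact G.lapMatrix_mulVec_const_eq_zero

theorem dotProduct_lap_mulVec_comm (x y : Fin n → ℝ) : x ⬝ᵥ lap G *ᵥ y = y ⬝ᵥ lap G *ᵥ x :=
  dotProduct_mulVec_comm (lap_isHermitian G) x y

theorem one_dotProduct_lap_mulVec (w : Fin n → ℝ) : 1 ⬝ᵥ lap G *ᵥ w = 0 := by
  rw [dotProduct_lap_mulVec_comm, lap_mulVec_one, dotProduct_zero]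

theorem mem_sumZero_of_lap_mulVec_eq_smul {v : Fin n → ℝ} {μ : ℝ} (hμ : μ ≠ 0)
    (hv : lap G *ᵥ v = μ • v) : v ∈ sumZero (Fin n) := by
  have h := one_dotProduct_lap_mulVec (G := G) v
  rw [hv, dotProduct_smul, smul_eq_mul] at h
  exact mem_sumZero.2 ((mul_eq_zero.1 h).resolve_left hμ)

theorem lamLap_anti {k l : ℕ} (hk : 1 ≤ k) (hkl : k ≤ l) (hl : l ≤ n) :
    lamLap G l ≤ lamLap G k := by
  rw [lamLap, lamLap, dif_pos ⟨by lia, by lia⟩, dif_pos ⟨by lia, by lia⟩]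
  exact (lap_isHermitian G).eigenvalues₀_antitone (Fin.mk_le_mk.2 (by lia))

theorem lamLap_le_of_orthogonal_family {k m : ℕ} (hk : 1 ≤ k) (hkn : k ≤ n)
    (e : Fin m → Fin n → ℝ) (he0 : ∀ j, e j ≠ 0) (he : Pairwise fun j k => e j ⬝ᵥ e k = 0)
    (hLe : Pairwise fun j k => e j ⬝ᵥ lap G *ᵥ e k = 0) (hm : n + 1 ≤ k + m) {c : ℝ}
    (h : ∀ j, e j ⬝ᵥ lap G *ᵥ e j ≤ c * (e j ⬝ᵥ e j)) : lamLap G k ≤ c := by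
  rw [lamLap, dif_pos ⟨hk, hkn⟩]
  exact eigenvalues₀_le_of_orthogonal_family _ _ e he0 he hLe (by simp; lia) h

theorem lamLap_mul_le_of_mem_sumZero (hn : 2 ≤ n) {w : Fin n → ℝ} (hw : w ∈ sumZero (Fin n)) :
    lamLap G (n - 1) * (w ⬝ᵥ w) ≤ w ⬝ᵥ lap G *ᵥ w := by
  rcases eq_or_ne w 0 with rfl | hw0
  · simp
  have : NeZero n := ⟨by lia⟩
  rw [mem_sumZero] at hw
  have hww := dotProduct_self_pos hw0
  rw [← le_div_iff₀ hww]
  have hRayleigh_nonneg : 0 ≤ w ⬝ᵥ lap G *ᵥ w / (w ⬝ᵥ w) :=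
    div_nonneg (dotProduct_lap_mulVec_self_nonneg w) hww.le
  refine lamLap_le_of_orthogonal_family (by lia) (by lia) ![1, w] ?_ ?_ ?_ (by lia) ?_
  · simp [Fin.forall_fin_two, hw0]
  · simp [Pairwise, Fin.forall_fin_two, hw, dotProduct_comm w 1]
  · simp [Pairwise, Fin.forall_fin_two, one_dotProduct_lap_mulVec, lap_mulVec_one]
  · refine Fin.forall_fin_two.2 ⟨?_, ?_⟩
    · simpa [lap_mulVec_one] using mul_nonneg hRayleigh_nonneg (Nat.cast_nonneg n)
    · exact (div_mul_cancel₀ _ hww.ne').ge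

theorem lamLap_mul_le_of_orthogonal_eigenvector (hn : 3 ≤ n) {v w : Fin n → ℝ} (hv0 : v ≠ 0)
    (hv1 : v ∈ sumZero (Fin n)) (hv : lap G *ᵥ v = lamLap G (n - 1) • v)
    (hw : w ∈ sumZero (Fin n)) (hvw : v ⬝ᵥ w = 0) :
    lamLap G (n - 2) * (w ⬝ᵥ w) ≤ w ⬝ᵥ lap G *ᵥ w := by
  rcases eq_or_ne w 0 with rfl | hw0
  · simp
  have : NeZero n := ⟨by lia⟩
  have hww := dotProduct_self_pos hw0
  have hRayleigh := lamLap_mul_le_of_mem_sumZero (G := G) (by lia) hw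
  rw [← le_div_iff₀ hww] at hRayleigh ⊢
  have hRayleigh_nonneg : 0 ≤ w ⬝ᵥ lap G *ᵥ w / (w ⬝ᵥ w) :=
    div_nonneg (dotProduct_lap_mulVec_self_nonneg w) hww.le
  rw [mem_sumZero] at hv1 hw
  have hvLw : v ⬝ᵥ lap G *ᵥ w = 0 := by
    rw [dotProduct_lap_mulVec_comm, hv, dotProduct_smul, dotProduct_comm, hvw, smul_zero]
  refine lamLap_le_of_orthogonal_family (by lia) (by lia) ![1, v, w] ?_ ?_ ?_ (by lia) ?_
  · simp [Fin.forall_fin_succ, hw0, hv0]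
  · simp [Pairwise, Fin.forall_fin_succ, hw, hv1, hvw, dotProduct_comm w, dotProduct_comm v 1]
  · simp [Pairwise, Fin.forall_fin_succ, one_dotProduct_lap_mulVec, lap_mulVec_one, hvLw,
      dotProduct_lap_mulVec_comm w v]
  · refine Fin.forall_fin_succ.2 ⟨?_, Fin.forall_fin_two.2 ⟨?_, ?_⟩⟩
    · simpa [lap_mulVec_one] using mul_nonneg hRayleigh_nonneg (Nat.cast_nonneg n)
    · simpa [hv] using mul_le_mul_of_nonneg_right hRayleigh (dotProduct_self_pos hv0).le
    · exact (div_mul_cancel₀ _ hww.ne').ge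

variable (G) in
theorem exists_mem_sumZero_dotProduct_lap_mulVec_le (hn : 2 ≤ n) :
    ∃ w ∈ sumZero (Fin n), w ≠ 0 ∧ w ⬝ᵥ lap G *ᵥ w ≤ lamLap G (n - 1) * (w ⬝ᵥ w) := by
  have : NeZero n := ⟨by lia⟩
  have hrank := finrank_sumZero_add_one (ι := Fin n)
  rw [Fintype.card_fin] at hrank
  rw [lamLap, dif_pos ⟨by lia, by lia⟩]
  exact exists_mem_dotProduct_mulVec_self_le_eigenvalues₀ _ _ _ (by dsimp only; lia)

theorem le_lamLap_of_forall_mem_sumZero (hn : 2 ≤ n) {c : ℝ}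
    (h : ∀ w ∈ sumZero (Fin n), c * (w ⬝ᵥ w) ≤ w ⬝ᵥ lap G *ᵥ w) : c ≤ lamLap G (n - 1) := by
  obtain ⟨w, hw, hw0, hle⟩ := exists_mem_sumZero_dotProduct_lap_mulVec_le G hn
  exact le_of_mul_le_mul_right ((h w hw).trans hle) (dotProduct_self_pos hw0)

theorem eq_of_dotProduct_lap_mulVec_self_nonpos (hG : G.Connected) {w : Fin n → ℝ}
    (hw : w ⬝ᵥ lap G *ᵥ w ≤ 0) (i j : Fin n) : w i = w j := by
  classical
  have h0 : w ⬝ᵥ G.lapMatrix ℝ *ᵥ w = 0 := le_antisymm hw (dotProduct_lap_mulVec_self_nonneg w)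
  rw [← toLinearMap₂'_apply'] at h0
  exact (G.lapMatrix_toLinearMap₂'_apply'_eq_zero_iff_forall_reachable w).1 h0 i j
    (hG.preconnected i j)

theorem lamLap_pos_of_connected (hn : 2 ≤ n) (hG : G.Connected) : 0 < lamLap G (n - 1) := by
  obtain ⟨w, hw, hw0, hle⟩ := exists_mem_sumZero_dotProduct_lap_mulVec_le G hn
  by_contra! hneg
  have hconst := eq_of_dotProduct_lap_mulVec_self_nonpos hG
    (hle.trans (mul_nonpos_of_nonpos_of_nonneg hneg (dotProduct_self_pos hw0).le))
  refine hw0 (funext fun i => ?_)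
  have hsum : ∑ j, w j = 0 := by simpa [dotProduct] using mem_sumZero.1 hw
  rw [Finset.sum_congr rfl fun j _ => hconst j i] at hsum
  simpa [show n ≠ 0 by lia] using hsum

open scoped Classical in
theorem lap_apply (i j : Fin n) :
    lap G i j = (if i = j then (G.degree i : ℝ) else 0) - if G.Adj i j then 1 else 0 := by
  simp only [lap, SimpleGraph.lapMatrix, SimpleGraph.degMatrix, Matrix.sub_apply, diagonal_apply,
    SimpleGraph.adjMatrix_apply]

open scoped Classical in
theorem lap_apply_self (i : Fin n) : lap G i i = G.degree i := by
  simp [lap_apply]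

theorem lap_apply_nonpos {i j : Fin n} (hij : i ≠ j) : lap G i j ≤ 0 := by
  classical
  rw [lap_apply, if_neg hij]
  split_ifs <;> norm_num

theorem dotProduct_lap_mulVec_self_le {d : ℝ} (hd : ∀ i, lap G i i ≤ d) (w : Fin n → ℝ) :
    w ⬝ᵥ lap G *ᵥ w ≤ 2 * d * (w ⬝ᵥ w) := by
  classical
  let a : Fin n → Fin n → ℝ := fun i j => if G.Adj i j then 1 else 0
  have hedge : ∀ i j, (if G.Adj i j then (w i - w j) ^ 2 else 0)
      ≤ 2 * (a i j * w i ^ 2) + 2 * (a j i * w j ^ 2) := by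
    intro i j
    simp only [a, G.adj_comm j i]
    split_ifs
    · linarith [sq_nonneg (w i + w j)]
    · simp
  have hdeg : ∑ i, ∑ j, a i j * w i ^ 2 ≤ d * (w ⬝ᵥ w) := by
    rw [dotProduct, Finset.mul_sum]
    refine Finset.sum_le_sum fun i _ => ?_
    rw [← Finset.sum_mul, ← SimpleGraph.degree_eq_sum_if_adj, ← lap_apply_self, ← sq]
    exact mul_le_mul_of_nonneg_right (hd i) (sq_nonneg _)
  have hsum := Finset.sum_le_sum fun i (_ : i ∈ Finset.univ) =>
    Finset.sum_le_sum fun j (_ : j ∈ Finset.univ) => hedge i j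
  simp only [Finset.sum_add_distrib, ← Finset.mul_sum] at hsum
  rw [Finset.sum_comm (f := fun i j => a j i * w j ^ 2)] at hsum
  rw [dotProduct_lap_mulVec_self]
  linarith

end Laplacian

section WeightMatrix

open Matrix

variable {n : ℕ} (G : SimpleGraph (Fin n)) {d : ℝ}

/-- The weight matrix `I - L / (2 (1 + d))` of a graph with Laplacian `L`; it averages the values of
neighbouring agents if `d` bounds the degrees. -/
noncomputable def weightMatrix (d : ℝ) : Matrix (Fin n) (Fin n) ℝ :=
  1 - (1 / (2 * (1 + d))) • lap G

/-- The factor `1 - λ_{n-1}(L) / (2 (1 + d))` by which the weight matrix of a graph with Laplacian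
`L` contracts the vectors of sum zero. -/
noncomputable def weightRate (d : ℝ) : ℝ :=
  1 - lamLap G (n - 1) / (2 * (1 + d))

variable {G}

theorem weightMatrix_mulVec (w : Fin n → ℝ) :
    weightMatrix G d *ᵥ w = w - (1 / (2 * (1 + d))) • lap G *ᵥ w := by
  rw [weightMatrix, sub_mulVec, one_mulVec, smul_mulVec]

theorem weightMatrix_mulVec_one : weightMatrix G d *ᵥ 1 = 1 := by
  rw [weightMatrix_mulVec, lap_mulVec_one, smul_zero, sub_zero]

theorem weightMatrix_isHermitian : (weightMatrix G d).IsHermitian :=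
  isHermitian_one.sub ((lap_isHermitian G).smul (IsSelfAdjoint.all _))

theorem one_dotProduct_weightMatrix_mulVec (w : Fin n → ℝ) :
    1 ⬝ᵥ weightMatrix G d *ᵥ w = 1 ⬝ᵥ w := by
  rw [dotProduct_mulVec_comm weightMatrix_isHermitian, weightMatrix_mulVec_one, dotProduct_comm]

theorem dotProduct_weightMatrix_mulVec_self (w : Fin n → ℝ) :
    w ⬝ᵥ weightMatrix G d *ᵥ w = w ⬝ᵥ w - (w ⬝ᵥ lap G *ᵥ w) / (2 * (1 + d)) := by
  rw [weightMatrix_mulVec, dotProduct_sub, dotProduct_smul, smul_eq_mul, one_div_mul_eq_div]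

theorem weightMatrix_apply_nonneg (hd0 : 0 ≤ d) (hd : ∀ i, lap G i i ≤ d) (i j : Fin n) :
    0 ≤ weightMatrix G d i j := by
  rw [weightMatrix, Matrix.sub_apply, Matrix.smul_apply, smul_eq_mul]
  rcases eq_or_ne i j with rfl | hij
  · rw [Matrix.one_apply_eq, one_div_mul_eq_div, sub_nonneg, div_le_one (by positivity)]
    linarith [hd i]
  · rw [Matrix.one_apply_ne hij, zero_sub, neg_nonneg]
    exact mul_nonpos_of_nonneg_of_nonpos (by positivity) (lap_apply_nonpos hij)

theorem weightMatrix_mem_doublyStochastic (hd0 : 0 ≤ d) (hd : ∀ i, lap G i i ≤ d) :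
    weightMatrix G d ∈ doublyStochastic ℝ (Fin n) := by
  refine mem_doublyStochastic.2
    ⟨weightMatrix_apply_nonneg hd0 hd, weightMatrix_mulVec_one, ?_⟩
  rw [← mulVec_transpose, ← conjTranspose_eq_transpose_of_trivial, weightMatrix_isHermitian,
    weightMatrix_mulVec_one]

theorem posSemidef_weightMatrix (hd0 : 0 ≤ d) (hd : ∀ i, lap G i i ≤ d) :
    (weightMatrix G d).PosSemidef := by
  refine .of_dotProduct_mulVec_nonneg weightMatrix_isHermitian fun w => ?_
  have hww : 0 ≤ w ⬝ᵥ w := by simpa using dotProduct_self_star_nonneg w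
  rw [star_trivial, dotProduct_weightMatrix_mulVec_self, sub_nonneg, div_le_iff₀ (by positivity)]
  linarith [dotProduct_lap_mulVec_self_le hd w]

theorem dotProduct_weightMatrix_mulVec_self_le (hn : 2 ≤ n) (hd0 : 0 ≤ d) {w : Fin n → ℝ}
    (hw : w ∈ sumZero (Fin n)) : w ⬝ᵥ weightMatrix G d *ᵥ w ≤ weightRate G d * (w ⬝ᵥ w) := by
  rw [dotProduct_weightMatrix_mulVec_self, weightRate, sub_mul, one_mul, div_mul_eq_mul_div]
  gcongr
  exact lamLap_mul_le_of_mem_sumZero hn hw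

theorem weightMatrix_contraction (hn : 2 ≤ n) (hd0 : 0 ≤ d) (hd : ∀ i, lap G i i ≤ d)
    (hs : 0 < weightRate G d) {w : Fin n → ℝ} (hw : w ∈ sumZero (Fin n)) :
    weightMatrix G d *ᵥ w ⬝ᵥ weightMatrix G d *ᵥ w ≤ weightRate G d ^ 2 * (w ⬝ᵥ w) :=
  mulVec_dotProduct_mulVec_le (posSemidef_weightMatrix hd0 hd) hs
    (fun w hw => by rw [mem_sumZero, one_dotProduct_weightMatrix_mulVec, mem_sumZero.1 hw])
    (fun _ hw => dotProduct_weightMatrix_mulVec_self_le hn hd0 hw) hw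

section CenteredSingle

variable {ι : Type*} [Fintype ι] [DecidableEq ι]

/-- The indicator of the node `i` minus its average, i.e. the deviation from consensus when only the
agent `i` holds a unit value. -/
noncomputable def centeredSingle (i : ι) : ι → ℝ :=
  Pi.single i 1 - (1 / (Fintype.card ι : ℝ)) • 1

theorem centeredSingle_mem_sumZero (i : ι) : centeredSingle i ∈ sumZero ι := by
  have : Nonempty ι := ⟨i⟩
  rw [mem_sumZero, centeredSingle, dotProduct_sub, dotProduct_smul, dotProduct_single_one]
  simp

theorem centeredSingle_dotProduct_self (i : ι) :
    centeredSingle i ⬝ᵥ centeredSingle i = 1 - 1 / (Fintype.card ι : ℝ) := by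
  conv_lhs => rw [centeredSingle, sub_dotProduct, smul_dotProduct, ← centeredSingle,
    mem_sumZero.1 (centeredSingle_mem_sumZero i)]
  simp [centeredSingle]

end CenteredSingle

theorem centeredSingle_dotProduct_lap_mulVec_self (i : Fin n) :
    centeredSingle i ⬝ᵥ lap G *ᵥ centeredSingle i = lap G i i := by
  rw [centeredSingle, sub_dotProduct, smul_dotProduct, one_dotProduct_lap_mulVec, smul_zero,
    sub_zero, mulVec_sub, mulVec_smul, lap_mulVec_one, smul_zero, sub_zero,
    single_one_dotProduct, mulVec_single_one, col_apply]

theorem half_le_weightRate (hn : 2 ≤ n) (hd0 : 0 ≤ d) (hd : ∀ i, lap G i i ≤ d)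
    (hdn : d ≤ n - 1) : 1 / 2 ≤ weightRate G d := by
  let i : Fin n := ⟨0, by lia⟩
  have hn2 : (2 : ℝ) ≤ n := by exact_mod_cast hn
  have hRayleigh : lamLap G (n - 1) * (1 - 1 / n) ≤ d := by
    have h := lamLap_mul_le_of_mem_sumZero (G := G) hn (centeredSingle_mem_sumZero i)
    rw [centeredSingle_dotProduct_self, centeredSingle_dotProduct_lap_mulVec_self,
      Fintype.card_fin] at h
    exact h.trans (hd i)
  have hlam : lamLap G (n - 1) * (n - 1) ≤ d * n := by
    calc lamLap G (n - 1) * (n - 1) = lamLap G (n - 1) * (1 - 1 / n) * n := by field_simp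
      _ ≤ d * n := by gcongr
  have hlam_le : lamLap G (n - 1) ≤ 1 + d :=
    le_of_mul_le_mul_right (a := (n : ℝ) - 1) (by linarith) (by linarith)
  rw [weightRate, le_sub_comm, div_le_iff₀ (by positivity)]
  linarith

theorem sigma2_weightMatrix_le (hn : 2 ≤ n) (hd0 : 0 ≤ d) (hd : ∀ i, lap G i i ≤ d)
    (hs : 0 < weightRate G d) : sigma2 (weightMatrix G d) ≤ weightRate G d := by
  have : NeZero n := ⟨by lia⟩
  refine singularValues_toEuclideanLin_le _ (by rwa [Fintype.card_fin]) hs.le (sumZero (Fin n)) ?_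
    fun w hw => weightMatrix_contraction hn hd0 hd hs hw
  rw [add_comm, finrank_sumZero_add_one]

theorem weightMatrix_mulVec_eigenvector {v : Fin n → ℝ}
    (hLv : lap G *ᵥ v = lamLap G (n - 1) • v) :
    weightMatrix G d *ᵥ v = weightRate G d • v := by
  rw [weightMatrix_mulVec, hLv, weightRate, sub_smul, one_smul, smul_smul, one_div_mul_eq_div]

theorem weightRate_le_sigma2_weightMatrix (hn : 2 ≤ n) (hd0 : 0 ≤ d) (hs : 0 ≤ weightRate G d)
    (hG : G.Connected) {v : Fin n → ℝ} (hv0 : v ≠ 0) (hLv : lap G *ᵥ v = lamLap G (n - 1) • v) :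
    weightRate G d ≤ sigma2 (weightMatrix G d) := by
  have : NeZero n := ⟨by lia⟩
  have hlam := lamLap_pos_of_connected hn hG
  have hs1 : weightRate G d ≤ 1 := by
    rw [weightRate, sub_le_self_iff]
    positivity
  have hv1 : 1 ⬝ᵥ v = 0 := mem_sumZero.1 (mem_sumZero_of_lap_mulVec_eq_smul hlam.ne' hLv)
  have hP1 := weightMatrix_mulVec_one (G := G) (d := d)
  have hPv := weightMatrix_mulVec_eigenvector (d := d) hLv
  refine le_singularValues_toEuclideanLin_of_orthogonal_family _ ![1, v] ?_ ?_ ?_ (by simp) ?_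
  · simp [Fin.forall_fin_two, hv0]
  · simp [Pairwise, Fin.forall_fin_two, hv1, dotProduct_comm v 1]
  · simp [Pairwise, Fin.forall_fin_two, hP1, hPv, hv1, dotProduct_comm v 1]
  · refine Fin.forall_fin_two.2 ⟨?_, ?_⟩
    · simpa [hP1] using mul_le_of_le_one_left (Nat.cast_nonneg n) (pow_le_one₀ hs hs1)
    · simp [hPv, sq, mul_assoc]

end WeightMatrix

section SpectralGain

open Matrix

variable {n : ℕ}

theorem edgeVec_dotProduct_self {l : Fin n × Fin n} (hl : l.1 ≠ l.2) :
    edgeVec l ⬝ᵥ edgeVec l = 2 := by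
  simp only [edgeVec, dotProduct_sub, dotProduct_single_one, Pi.sub_apply, Pi.single_eq_same,
    Pi.single_eq_of_ne hl, Pi.single_eq_of_ne hl.symm]
  norm_num

theorem dotProduct_mulVec_self_smul_add {ι : Type*} [Fintype ι] {A : Matrix ι ι ℝ}
    (hA : A.IsHermitian) {v y : ι → ℝ} {μ : ℝ} (hv : A *ᵥ v = μ • v) (hvy : v ⬝ᵥ y = 0) (s : ℝ) :
    (s • v + y) ⬝ᵥ A *ᵥ (s • v + y) = μ * s ^ 2 * (v ⬝ᵥ v) + y ⬝ᵥ A *ᵥ y := by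
  have hyv : y ⬝ᵥ v = 0 := by rw [dotProduct_comm, hvy]
  have hvAy : v ⬝ᵥ A *ᵥ y = 0 := by
    rw [dotProduct_mulVec_comm hA, hv, dotProduct_smul, hyv, smul_zero]
  simp only [mulVec_add, mulVec_smul, dotProduct_add, add_dotProduct, dotProduct_smul,
    smul_dotProduct, hvAy, hv, hyv, smul_eq_mul]
  ring

-- `g + 6` makes the difference of the two sides a nonnegative combination of the hypotheses and of
-- the square of `6 * (s * p + r) + g * r`.
theorem gain_scalar_bound {g p r s Y : ℝ} (hg : 0 ≤ g) (hY : 0 ≤ Y) (hp : p ^ 2 ≤ 2)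
    (hr : r ^ 2 ≤ 2 * Y) :
    p ^ 2 * g * (s ^ 2 + Y) ≤ (g + 6) * (g * Y + (s * p + r) ^ 2) := by
  have hgYp := mul_nonneg (mul_nonneg hg hY) (sub_nonneg.2 hp)
  have hgr := mul_nonneg hg (sub_nonneg.2 hr)
  have hggr := mul_nonneg (mul_nonneg hg hg) (sub_nonneg.2 hr)
  have hggY := mul_nonneg (mul_nonneg hg hg) hY
  have hgY := mul_nonneg hg hY
  nlinarith [sq_nonneg (6 * (s * p + r) + g * r)]

variable {G G' : SimpleGraph (Fin n)} {a v : Fin n → ℝ} {g : ℝ}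

theorem lamLap_add_mul_le_smul_add (hn : 3 ≤ n) (ha : a ⬝ᵥ a ≤ 2) (hv : v ⬝ᵥ v = 1)
    (hv1 : v ∈ sumZero (Fin n)) (hLv : lap G *ᵥ v = lamLap G (n - 1) • v)
    (hg : g = lamLap G (n - 2) - lamLap G (n - 1)) {y : Fin n → ℝ} (hy : y ∈ sumZero (Fin n))
    (hvy : v ⬝ᵥ y = 0) (s : ℝ) :
    (lamLap G (n - 1) + (a ⬝ᵥ v) ^ 2 * g / (g + 6)) * ((s • v + y) ⬝ᵥ (s • v + y))
      ≤ (s • v + y) ⬝ᵥ lap G *ᵥ (s • v + y) + (a ⬝ᵥ (s • v + y)) ^ 2 := by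
  have hv0 : v ≠ 0 := by
    rintro rfl
    simp at hv
  have hg0 : 0 ≤ g := by
    rw [hg, sub_nonneg]
    exact lamLap_anti (by lia) (by lia) (by lia)
  have hyy : 0 ≤ y ⬝ᵥ y := by simpa using dotProduct_self_star_nonneg y
  have hp : (a ⬝ᵥ v) ^ 2 ≤ 2 := by
    have h := dotProduct_sq_le a v
    rw [hv, mul_one] at h
    exact h.trans ha
  have hr : (a ⬝ᵥ y) ^ 2 ≤ 2 * (y ⬝ᵥ y) :=
    (dotProduct_sq_le a y).trans (mul_le_mul_of_nonneg_right ha hyy)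
  have hgain : (a ⬝ᵥ v) ^ 2 * g / (g + 6) * (s ^ 2 + y ⬝ᵥ y)
      ≤ g * (y ⬝ᵥ y) + (s * (a ⬝ᵥ v) + a ⬝ᵥ y) ^ 2 := by
    rw [div_mul_eq_mul_div, div_le_iff₀' (by positivity)]
    exact gain_scalar_bound hg0 hyy hp hr
  have hnorm : (s • v + y) ⬝ᵥ (s • v + y) = s ^ 2 + y ⬝ᵥ y := by
    simpa [hv] using dotProduct_mulVec_self_smul_add isHermitian_one (μ := 1) (by simp) hvy s
  have hform := dotProduct_mulVec_self_smul_add (lap_isHermitian G) hLv hvy s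
  rw [hnorm, hform, hv, mul_one, dotProduct_add, dotProduct_smul, smul_eq_mul, add_mul, mul_add]
  have hLy : (lamLap G (n - 1) + g) * (y ⬝ᵥ y) ≤ y ⬝ᵥ lap G *ᵥ y := by
    rw [hg, add_sub_cancel]
    exact lamLap_mul_le_of_orthogonal_eigenvector hn hv0 hv1 hLv hy hvy
  linarith

theorem lamLap_add_le_of_rank_one_update (hn : 3 ≤ n) (ha : a ⬝ᵥ a ≤ 2)
    (hG' : ∀ w, w ⬝ᵥ lap G' *ᵥ w = w ⬝ᵥ lap G *ᵥ w + (a ⬝ᵥ w) ^ 2) (hv : v ⬝ᵥ v = 1)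
    (hv1 : v ∈ sumZero (Fin n)) (hLv : lap G *ᵥ v = lamLap G (n - 1) • v)
    (hg : g = lamLap G (n - 2) - lamLap G (n - 1)) :
    lamLap G (n - 1) + (a ⬝ᵥ v) ^ 2 * g / (g + 6) ≤ lamLap G' (n - 1) := by
  refine le_lamLap_of_forall_mem_sumZero (by lia) fun w hw => ?_
  have hvy : v ⬝ᵥ (w - (v ⬝ᵥ w) • v) = 0 := by
    rw [dotProduct_sub, dotProduct_smul, hv, smul_eq_mul, mul_one, sub_self]
  have h := lamLap_add_mul_le_smul_add hn ha hv hv1 hLv hg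
    (sub_mem hw (Submodule.smul_mem _ (v ⬝ᵥ w) hv1)) hvy (v ⬝ᵥ w)
  rwa [add_sub_cancel, ← hG'] at h

end SpectralGain

section TwoNodes

open Matrix

theorem adj_of_lamLap_pos {G : SimpleGraph (Fin 2)} (hG : 0 < lamLap G 1) {i j : Fin 2}
    (hij : i ≠ j) : G.Adj i j := by
  by_contra hadj
  have hempty : ∀ a b, ¬ G.Adj a b := by
    intro a b hab
    have hne := hab.ne
    obtain ⟨rfl, rfl⟩ | ⟨rfl, rfl⟩ : (a = i ∧ b = j) ∨ (a = j ∧ b = i) := by omega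
    · exact hadj hab
    · exact hadj hab.symm
  obtain ⟨w, hw, hw0⟩ : ∃ w ∈ sumZero (Fin 2), w ≠ 0 :=
    have ⟨w, hw, hw0, _⟩ := exists_mem_sumZero_dotProduct_lap_mulVec_le G le_rfl
    ⟨w, hw, hw0⟩
  have hform : w ⬝ᵥ lap G *ᵥ w = 0 := by
    simp only [dotProduct_lap_mulVec_self, hempty, if_false, Finset.sum_const_zero, zero_div]
  exact (mul_pos hG (dotProduct_self_pos hw0)).not_ge
    ((lamLap_mul_le_of_mem_sumZero le_rfl hw).trans_eq hform)

end TwoNodes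

namespace EvolvingNetwork

open Matrix

variable {n T : ℕ} (N : EvolvingNetwork n T)

/-- The factor by which `P t` contracts the vectors of sum zero. -/
noncomputable def rate (t : ℕ) : ℝ :=
  weightRate (N.G t) N.degMax

/-- The summand of `EvolvingNetwork.decrease` contributed by the edge added to `G t`. -/
noncomputable def gain (v : ℕ → Fin n → ℝ) (t : ℕ) : ℝ :=
  N.u (t + 1) * N.b t * (edgeVec (N.l (t + 1)) ⬝ᵥ v t) ^ 2

theorem lap_G_eq_of_le {t : ℕ} (ht : T ≤ t) : lap (N.G t) = lap (N.G T) := by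
  induction t, ht using Nat.le_induction with
  | base => rfl
  | succ t ht ih =>
    rw [N.step (t + 1) t.succ_pos, N.u_after _ (Nat.lt_succ_of_le ht), zero_smul, add_zero,
      Nat.add_sub_cancel, ih]

theorem lap_apply_self_le_degMax (t : ℕ) (i : Fin n) : lap (N.G t) i i ≤ N.degMax := by
  classical
  wlog ht : t ≤ T generalizing t
  · rw [N.lap_G_eq_of_le (le_of_not_ge ht)]
    exact this T le_rfl
  rw [lap_apply_self, degMax]
  refine Nat.cast_le.2 (((N.G t).degree_le_maxDegree i).trans ?_)
  convert Finset.le_sup (f := fun t => (N.G t).maxDegree) (Finset.mem_range_succ_iff.2 ht)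

theorem degMax_le (hn : 2 ≤ n) : (N.degMax : ℝ) ≤ n - 1 := by
  classical
  have : Nonempty (Fin n) := ⟨⟨0, by lia⟩⟩
  rw [le_sub_iff_add_le, ← Nat.cast_add_one, Nat.cast_le, Nat.add_one_le_iff, degMax,
    Finset.sup_lt_iff (by simp; lia)]
  intro t _
  simpa using (N.G t).maxDegree_lt_card_verts

theorem half_le_rate (hn : 2 ≤ n) (t : ℕ) : 1 / 2 ≤ N.rate t :=
  half_le_weightRate hn (Nat.cast_nonneg _) (N.lap_apply_self_le_degMax t) (N.degMax_le hn)

theorem rate_pos (hn : 2 ≤ n) (t : ℕ) : 0 < N.rate t :=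
  one_half_pos.trans_le (N.half_le_rate hn t)

theorem dotProduct_lap_succ_mulVec_self (t : ℕ) (w : Fin n → ℝ) :
    w ⬝ᵥ lap (N.G (t + 1)) *ᵥ w
      = w ⬝ᵥ lap (N.G t) *ᵥ w + N.u (t + 1) * (edgeVec (N.l (t + 1)) ⬝ᵥ w) ^ 2 := by
  rw [N.step (t + 1) t.succ_pos, Nat.add_sub_cancel, add_mulVec, dotProduct_add, smul_mulVec,
    dotProduct_smul, vecMulVec_mulVec, dotProduct_smul, dotProduct_comm w (edgeVec _), sq]
  rfl

theorem u_nonneg (t : ℕ) : 0 ≤ N.u t := by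
  rcases N.u_binary t with h | h <;> simp [h]

theorem lamLap_monotone (hn : 2 ≤ n) : Monotone fun t => lamLap (N.G t) (n - 1) := by
  refine monotone_nat_of_le_succ fun t => le_lamLap_of_forall_mem_sumZero hn fun w hw => ?_
  rw [dotProduct_lap_succ_mulVec_self]
  exact (lamLap_mul_le_of_mem_sumZero hn hw).trans
    (le_add_of_nonneg_right (mul_nonneg (N.u_nonneg _) (sq_nonneg _)))

theorem lamLap_pos (hn : 2 ≤ n) (t : ℕ) : 0 < lamLap (N.G t) (n - 1) :=
  (lamLap_pos_of_connected hn N.connected).trans_le (N.lamLap_monotone hn (Nat.zero_le t))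

theorem rate_antitone (hn : 2 ≤ n) : Antitone N.rate := by
  intro s t hst
  unfold rate weightRate
  gcongr
  exact N.lamLap_monotone hn hst

theorem rate_lt_one (hn : 2 ≤ n) (t : ℕ) : N.rate t < 1 := by
  have hlam := N.lamLap_pos hn t
  rw [rate, weightRate, sub_lt_self_iff]
  positivity

theorem three_le_of_u_succ_eq_one (hn : 2 ≤ n) {t : ℕ} (hu : N.u (t + 1) = 1) : 3 ≤ n := by
  by_contra! h
  obtain rfl : n = 2 := by lia
  obtain ⟨hne, hadj⟩ := N.l_new _ t.succ_pos hu
  exact hadj (adj_of_lamLap_pos (N.lamLap_pos hn t) hne)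

theorem gap_nonneg (hn : 3 ≤ n) (t : ℕ) : 0 ≤ N.gap t :=
  sub_nonneg.2 (lamLap_anti (by lia) (by lia) (by lia))

theorem b_eq_of_gap_pos {t : ℕ} (hg : 0 < N.gap t) :
    N.b t = N.gap t / (N.gap t + 6) / (2 * (1 + N.degMax)) := by
  rw [b, if_neg hg.ne']
  field_simp
  ring

theorem b_nonneg (hn : 3 ≤ n) (t : ℕ) : 0 ≤ N.b t := by
  have hg := N.gap_nonneg hn t
  unfold b
  split_ifs <;> positivity

theorem gain_nonneg (hn : 2 ≤ n) (v : ℕ → Fin n → ℝ) (t : ℕ) : 0 ≤ N.gain v t := by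
  rcases N.u_binary (t + 1) with hu | hu
  · simp [gain, hu]
  · exact mul_nonneg (mul_nonneg (N.u_nonneg _)
      (N.b_nonneg (N.three_le_of_u_succ_eq_one hn hu) t)) (sq_nonneg _)

variable {N} {v : ℕ → Fin n → ℝ}

theorem rate_succ_le_sub_gain (hn : 2 ≤ n) (hv : N.IsConnectivityEigenvector v) (t : ℕ) :
    N.rate (t + 1) ≤ N.rate t - N.gain v t := by
  have hmono := N.rate_antitone hn t.le_succ
  rcases N.u_binary (t + 1) with hu | hu
  · simpa [gain, hu] using hmono
  have hn3 := N.three_le_of_u_succ_eq_one hn hu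
  rcases (N.gap_nonneg hn3 t).eq_or_lt' with hg | hg
  · simpa [gain, b, hg] using hmono
  have ht : t < T := by
    by_contra! h
    exact one_ne_zero (hu.symm.trans (N.u_after _ (Nat.lt_succ_of_le h)))
  obtain ⟨hv1, hLv⟩ := hv t ht.le
  have hgain := lamLap_add_le_of_rank_one_update (G' := N.G (t + 1)) hn3
    (edgeVec_dotProduct_self (N.l_new _ t.succ_pos hu).1).le
    (fun w => by rw [dotProduct_lap_succ_mulVec_self, hu, one_mul]) hv1
    (mem_sumZero_of_lap_mulVec_eq_smul (N.lamLap_pos hn t).ne' hLv) hLv rfl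
  rw [gain, hu, one_mul, N.b_eq_of_gap_pos hg, div_mul_eq_mul_div, mul_comm (_ / _),
    ← mul_div_assoc, rate, rate, weightRate, weightRate, sub_sub, ← add_div]
  gcongr
  exact hgain

theorem decrease_zero : N.decrease v 0 = 0 := by
  simp [decrease]

theorem decrease_succ (k : ℕ) : N.decrease v (k + 1) = N.decrease v k + N.gain v k := by
  rw [decrease, decrease, Finset.sum_Icc_succ_top k.succ_pos, Nat.add_sub_cancel, gain]

theorem decrease_nonneg (hn : 2 ≤ n) (k : ℕ) : 0 ≤ N.decrease v k := by
  rw [← decrease_zero (N := N) (v := v)]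
  refine monotone_nat_of_le_succ (fun j => ?_) (Nat.zero_le k)
  rw [decrease_succ]
  exact le_add_of_nonneg_right (N.gain_nonneg hn v j)

theorem rate_le_rate_zero_sub_decrease (hn : 2 ≤ n) (hv : N.IsConnectivityEigenvector v) (k : ℕ) :
    N.rate k ≤ N.rate 0 - N.decrease v k := by
  induction k with
  | zero => rw [decrease_zero, sub_zero]
  | succ k ih =>
    rw [decrease_succ]
    linarith [rate_succ_le_sub_gain hn hv k]

theorem half_le_rate_zero_sub_decrease (hn : 2 ≤ n) (hv : N.IsConnectivityEigenvector v) (k : ℕ) :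
    1 / 2 ≤ N.rate 0 - N.decrease v k :=
  (N.half_le_rate hn k).trans (rate_le_rate_zero_sub_decrease hn hv k)

theorem sigma2_P_zero (hn : 2 ≤ n) (hv : N.IsConnectivityEigenvector v) :
    sigma2 (N.P 0) = N.rate 0 := by
  obtain ⟨hv1, hLv⟩ := hv 0 T.zero_le
  have hd : (0 : ℝ) ≤ N.degMax := Nat.cast_nonneg _
  refine le_antisymm
    (sigma2_weightMatrix_le hn hd (N.lap_apply_self_le_degMax 0) (N.rate_pos hn 0))
    (weightRate_le_sigma2_weightMatrix hn hd (N.rate_pos hn 0).le N.connected ?_ hLv)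
  rintro h
  simp [h] at hv1

variable (N v) in
/-- The bound `∏_{k < m} (σ₂(P_0) - decrease k)` on the contraction by `m` successive weight
matrices; a pair `(β, δ)` is feasible for the mixing time problem only if `β` is this bound for
`m = δ`, divided by `σ₂(P_0) ^ δ`. -/
noncomputable def windowBound (m : ℕ) : ℝ :=
  ∏ k ∈ Finset.range m, (N.rate 0 - N.decrease v k)

theorem windowBound_pos (hn : 2 ≤ n) (hv : N.IsConnectivityEigenvector v) (m : ℕ) :
    0 < N.windowBound v m :=
  Finset.prod_pos fun k _ => one_half_pos.trans_le (half_le_rate_zero_sub_decrease hn hv k)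

theorem half_pow_le_windowBound (hn : 2 ≤ n) (hv : N.IsConnectivityEigenvector v) (m : ℕ) :
    (1 / 2) ^ m ≤ N.windowBound v m := by
  simpa [windowBound] using Finset.prod_le_prod (s := Finset.range m) (fun _ _ => one_half_pos.le)
    fun k _ => half_le_rate_zero_sub_decrease hn hv k

theorem windowBound_le_pow (hn : 2 ≤ n) (hv : N.IsConnectivityEigenvector v) (m : ℕ) :
    N.windowBound v m ≤ N.rate 0 ^ m := by
  simpa [windowBound] using Finset.prod_le_prod (s := Finset.range m)
    (fun k _ => one_half_pos.le.trans (half_le_rate_zero_sub_decrease hn hv k))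
    fun k _ => sub_le_self (N.rate 0) (decrease_nonneg (v := v) hn k)

theorem windowBound_antitone (hn : 2 ≤ n) (hv : N.IsConnectivityEigenvector v) :
    Antitone (N.windowBound v) := by
  refine antitone_nat_of_succ_le fun m => ?_
  rw [windowBound, Finset.prod_range_succ]
  exact mul_le_of_le_one_right (windowBound_pos hn hv m).le
    ((sub_le_self _ (decrease_nonneg hn m)).trans (N.rate_lt_one hn 0).le)

theorem prod_rate_le_windowBound (hn : 2 ≤ n) (hv : N.IsConnectivityEigenvector v) (r m : ℕ) :
    ∏ k ∈ Finset.range m, N.rate (r + k) ≤ N.windowBound v m :=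
  Finset.prod_le_prod (fun _ _ => (N.rate_pos hn _).le) fun k _ =>
    (N.rate_antitone hn (Nat.le_add_left k r)).trans (rate_le_rate_zero_sub_decrease hn hv k)

theorem log_windowBound (hn : 2 ≤ n) (hv : N.IsConnectivityEigenvector v) (m : ℕ) :
    Real.log (N.windowBound v (m + 1)) = (m + 1 : ℕ) * Real.log (N.rate 0)
      + ∑ k ∈ Finset.Icc 1 m, Real.log (1 - N.decrease v k / N.rate 0) := by
  have hs := N.rate_pos hn 0
  have hfactor : ∀ k, 0 < N.rate 0 - N.decrease v k := fun k =>
    one_half_pos.trans_le (half_le_rate_zero_sub_decrease hn hv k)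
  have hlog : ∀ k, Real.log (N.rate 0 - N.decrease v k)
      = Real.log (N.rate 0) + Real.log (1 - N.decrease v k / N.rate 0) := by
    intro k
    rw [one_sub_div hs.ne', Real.log_div (hfactor k).ne' hs.ne', add_sub_cancel]
  rw [windowBound, Real.log_prod fun k _ => (hfactor k).ne', Finset.sum_congr rfl fun k _ => hlog k,
    Finset.sum_add_distrib, Finset.sum_const, Finset.card_range, nsmul_eq_mul,
    Finset.sum_range_succ', decrease_zero, zero_div, sub_zero, Real.log_one, add_zero,
    Finset.range_eq_Ico, Finset.sum_Ico_add' (fun k => Real.log (1 - N.decrease v k / N.rate 0)),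
    zero_add, Finset.Ico_add_one_right_eq_Icc]

end EvolvingNetwork

section WindowProd

variable {M : Type*} [Monoid M]

/-- The product `P r * ⋯ * P (r + m - 1)` over the window of length `m` starting at time `r`. -/
def windowProd (P : ℕ → M) (r m : ℕ) : M :=
  ((List.range m).map fun k => P (r + k)).prod

theorem windowProd_zero (P : ℕ → M) (r : ℕ) : windowProd P r 0 = 1 :=
  rfl

theorem windowProd_succ (P : ℕ → M) (r m : ℕ) :
    windowProd P r (m + 1) = windowProd P r m * P (r + m) := by
  simp [windowProd, List.range_succ]

theorem windowProd_mem {P : ℕ → M} {S : Submonoid M} (h : ∀ t, P t ∈ S) (r m : ℕ) :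
    windowProd P r m ∈ S :=
  S.list_prod_mem (by simp [h])

end WindowProd

section Consensus

open Matrix

variable {ι : Type*} [Fintype ι] {P : ℕ → Matrix ι ι ℝ} {M : Matrix ι ι ℝ}

/-- The `ℓ¹` distance of a column of a matrix to the uniform distribution. -/
noncomputable def columnError (M : Matrix ι ι ℝ) (i : ι) : ℝ :=
  ∑ j, |M j i - 1 / (Fintype.card ι : ℝ)|

theorem sq_sum_abs_le (x : ι → ℝ) : (∑ j, |x j|) ^ 2 ≤ Fintype.card ι * (x ⬝ᵥ x) := by
  simpa [dotProduct, sq] using dotProduct_sq_le (1 : ι → ℝ) fun j => |x j|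

theorem sum_range_le_of_forall_le {f : ℕ → ℝ} {c ε : ℝ} (hc : 0 ≤ c) (hε : 0 ≤ ε) {δ t : ℕ}
    (hf : ∀ m < t, f m ≤ c) (hfε : ∀ m < t, δ ≤ m → f m ≤ ε) :
    ∑ m ∈ Finset.range t, f m ≤ δ * c + t * ε := by
  calc ∑ m ∈ Finset.range t, f m
      ≤ ∑ m ∈ Finset.range t, ((if m < δ then c else 0) + ε) := by
        refine Finset.sum_le_sum fun m hm => ?_
        rw [Finset.mem_range] at hm
        split_ifs with h
        · exact (hf m hm).trans (le_add_of_nonneg_right hε)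
        · simpa using hfε m hm (not_lt.1 h)
    _ = ((Finset.range t).filter (· < δ)).card * c + t * ε := by
        rw [Finset.sum_add_distrib, ← Finset.sum_filter]
        simp
    _ ≤ δ * c + t * ε := by
        gcongr
        calc ((Finset.range t).filter (· < δ)).card ≤ (Finset.range δ).card :=
              Finset.card_le_card fun m hm => Finset.mem_range.2 (Finset.mem_filter.1 hm).2
          _ = δ := Finset.card_range δ

variable [DecidableEq ι]

theorem mulVec_mem_sumZero (hM : M ∈ doublyStochastic ℝ ι) {w : ι → ℝ} (hw : w ∈ sumZero ι) :
    M *ᵥ w ∈ sumZero ι := by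
  rw [mem_sumZero, dotProduct_mulVec, one_vecMul_of_mem_doublyStochastic hM, mem_sumZero.1 hw]

theorem mulVec_centeredSingle (hM : M ∈ doublyStochastic ℝ ι) (i j : ι) :
    (M *ᵥ centeredSingle i) j = M j i - 1 / (Fintype.card ι : ℝ) := by
  rw [centeredSingle, mulVec_sub, mulVec_smul, mulVec_one_of_mem_doublyStochastic hM]
  simp

theorem columnError_le_two (hM : M ∈ doublyStochastic ℝ ι) (i : ι) : columnError M i ≤ 2 := by
  have : Nonempty ι := ⟨i⟩
  calc columnError M i ≤ ∑ j, (M j i + 1 / (Fintype.card ι : ℝ)) := by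
        refine Finset.sum_le_sum fun j _ => (abs_sub _ _).trans_eq ?_
        rw [abs_of_nonneg (nonneg_of_mem_doublyStochastic hM), abs_of_nonneg (by positivity)]
    _ = 1 + 1 := by
        rw [Finset.sum_add_distrib, sum_col_of_mem_doublyStochastic hM]
        simp
    _ = 2 := one_add_one_eq_two

theorem columnError_le_of_contraction (hM : M ∈ doublyStochastic ℝ ι) {c : ℝ} (hc : 0 ≤ c)
    (h : ∀ w ∈ sumZero ι, M *ᵥ w ⬝ᵥ M *ᵥ w ≤ c ^ 2 * (w ⬝ᵥ w)) (i : ι) :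
    columnError M i ≤ √(Fintype.card ι) * c := by
  have hcs : M *ᵥ centeredSingle i ⬝ᵥ M *ᵥ centeredSingle i ≤ c ^ 2 := by
    refine (h _ (centeredSingle_mem_sumZero i)).trans (mul_le_of_le_one_right (sq_nonneg c) ?_)
    rw [centeredSingle_dotProduct_self, sub_le_self_iff]
    positivity
  refine le_of_sq_le_sq ?_ (by positivity)
  rw [mul_pow, Real.sq_sqrt (Nat.cast_nonneg _)]
  simpa only [columnError, mulVec_centeredSingle hM] using
    (sq_sum_abs_le (M *ᵥ centeredSingle i)).trans
      (mul_le_mul_of_nonneg_left hcs (Nat.cast_nonneg _))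

theorem windowProd_contraction (hP : ∀ t, P t ∈ doublyStochastic ℝ ι) {c : ℕ → ℝ}
    (h : ∀ t, ∀ w ∈ sumZero ι, P t *ᵥ w ⬝ᵥ P t *ᵥ w ≤ c t ^ 2 * (w ⬝ᵥ w)) (r m : ℕ) :
    ∀ w ∈ sumZero ι, windowProd P r m *ᵥ w ⬝ᵥ windowProd P r m *ᵥ w
      ≤ (∏ k ∈ Finset.range m, c (r + k)) ^ 2 * (w ⬝ᵥ w) := by
  induction m with
  | zero => simp [windowProd_zero]
  | succ m ih =>
    intro w hw
    rw [windowProd_succ, ← mulVec_mulVec, Finset.prod_range_succ, mul_pow, mul_assoc]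
    exact (ih _ (mulVec_mem_sumZero (hP _) hw)).trans
      (mul_le_mul_of_nonneg_left (h _ w hw) (sq_nonneg _))

variable {F : Type*} [NormedAddCommGroup F] [NormedSpace ℝ F] {z g : ℕ → ι → F}

/-- The average of the values held by the nodes of a network. -/
noncomputable def nodeAverage (g : ι → F) : F :=
  (1 / (Fintype.card ι : ℝ)) • ∑ i, g i

omit [DecidableEq ι] in
theorem norm_nodeAverage_le [Nonempty ι] {g : ι → F} {L : ℝ} (hg : ∀ i, ‖g i‖ ≤ L) :
    ‖nodeAverage g‖ ≤ L := by
  rw [nodeAverage, norm_smul, Real.norm_of_nonneg (by positivity), one_div_mul_eq_div,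
    div_le_iff₀' (by positivity)]
  simpa using norm_sum_le_of_le Finset.univ fun i _ => hg i

theorem eq_sum_windowProd_of_recursion (h0 : ∀ i, z 0 i = 0) {t : ℕ}
    (hstep : ∀ s < t, ∀ i, z (s + 1) i = (∑ j, P s j i • z s j) + g s i) (i : ι) :
    z t i = ∑ r ∈ Finset.range t, ∑ j, windowProd P (r + 1) (t - 1 - r) j i • g r j := by
  induction t generalizing i with
  | zero => simp [h0]
  | succ t ih =>
    have hzt := ih fun s hs => hstep s (hs.trans t.lt_succ_self)
    have hwindow : ∀ r ∈ Finset.range t,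
        ∑ j, windowProd P (r + 1) (t + 1 - 1 - r) j i • g r j
          = ∑ k, P t k i • ∑ j, windowProd P (r + 1) (t - 1 - r) j k • g r j := by
      intro r hr
      rw [Finset.mem_range] at hr
      rw [show t + 1 - 1 - r = (t - 1 - r) + 1 by lia, windowProd_succ,
        show r + 1 + (t - 1 - r) = t by lia]
      simp only [Matrix.mul_apply, Finset.sum_smul, Finset.smul_sum, smul_smul, mul_comm (P t _ i)]
      exact Finset.sum_comm
    rw [hstep t t.lt_succ_self, Finset.sum_range_succ, Finset.sum_congr rfl hwindow,
      Finset.sum_comm]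
    simp only [hzt, Finset.smul_sum, Nat.add_sub_cancel, Nat.sub_self, windowProd_zero,
      Matrix.one_apply, ite_smul, one_smul, zero_smul, Finset.sum_ite_eq', Finset.mem_univ, if_true]

theorem norm_sub_sum_nodeAverage_le {L : ℝ} (h0 : ∀ i, z 0 i = 0) {t : ℕ}
    (hstep : ∀ s < t, ∀ i, z (s + 1) i = (∑ j, P s j i • z s j) + g s i)
    (hg : ∀ s < t, ∀ i, ‖g s i‖ ≤ L) (i : ι) :
    ‖z t i - ∑ r ∈ Finset.range t, nodeAverage (g r)‖
      ≤ (∑ r ∈ Finset.range t, columnError (windowProd P (r + 1) (t - 1 - r)) i) * L := by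
  rw [eq_sum_windowProd_of_recursion h0 hstep, ← Finset.sum_sub_distrib, Finset.sum_mul]
  refine norm_sum_le_of_le _ fun r hr => ?_
  rw [nodeAverage, Finset.smul_sum, ← Finset.sum_sub_distrib, columnError, Finset.sum_mul]
  refine norm_sum_le_of_le _ fun j _ => ?_
  rw [← sub_smul, norm_smul, Real.norm_eq_abs]
  exact mul_le_mul_of_nonneg_left (hg r (Finset.mem_range.1 hr) j) (abs_nonneg _)

end Consensus

namespace EvolvingNetwork

variable {n T : ℕ} {N : EvolvingNetwork n T} {v : ℕ → Fin n → ℝ}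

theorem P_mem_doublyStochastic (t : ℕ) : N.P t ∈ doublyStochastic ℝ (Fin n) :=
  weightMatrix_mem_doublyStochastic (Nat.cast_nonneg _) (N.lap_apply_self_le_degMax t)

theorem columnError_windowProd_le (hn : 2 ≤ n) (hv : N.IsConnectivityEigenvector v) (r m : ℕ)
    (i : Fin n) : columnError (windowProd N.P r m) i ≤ √n * N.windowBound v m := by
  have hcontraction := windowProd_contraction P_mem_doublyStochastic (fun t w hw =>
    weightMatrix_contraction hn (Nat.cast_nonneg _) (N.lap_apply_self_le_degMax t)
      (N.rate_pos hn t) hw) r m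
  have hle := columnError_le_of_contraction (windowProd_mem P_mem_doublyStochastic r m)
    (Finset.prod_nonneg fun k _ => (N.rate_pos hn _).le) hcontraction i
  rw [Fintype.card_fin] at hle
  exact hle.trans
    (mul_le_mul_of_nonneg_left (prod_rate_le_windowBound hn hv r m) (Real.sqrt_nonneg _))

theorem sum_columnError_windowProd_le (hn : 2 ≤ n) (hT : 1 ≤ T)
    (hv : N.IsConnectivityEigenvector v) {δ t : ℕ} (hδ : T * √n * N.windowBound v δ ≤ 1)
    (ht : t ≤ T) (i : Fin n) :
    ∑ r ∈ Finset.range t, columnError (windowProd N.P (r + 1) (t - 1 - r)) i ≤ 2 * δ + 1 := by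
  have hT0 : (0 : ℝ) < T := by exact_mod_cast hT
  have hlate : ∀ r m, δ ≤ m → columnError (windowProd N.P r m) i ≤ 1 / T := by
    intro r m hm
    rw [le_div_iff₀ hT0]
    calc columnError (windowProd N.P r m) i * T ≤ √n * N.windowBound v m * T := by
          gcongr
          exact columnError_windowProd_le hn hv r m i
      _ ≤ √n * N.windowBound v δ * T := by
          gcongr
          exact windowBound_antitone hn hv hm
      _ ≤ 1 := by linarith
  rw [← Finset.sum_range_reflect]
  refine (sum_range_le_of_forall_le (c := 2) (ε := 1 / T) (δ := δ) zero_le_two (by positivity)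
    (fun m _ => columnError_le_two (windowProd_mem P_mem_doublyStochastic _ _) i)
    fun m hm hδm => hlate _ _ (by lia)).trans ?_
  have htT : (t : ℝ) * (1 / T) ≤ 1 := by
    rw [mul_one_div, div_le_one hT0]
    exact_mod_cast ht
  linarith

theorem log_inv_rate_pos (hn : 2 ≤ n) (t : ℕ) : 0 < Real.log (N.rate t)⁻¹ :=
  Real.log_pos ((one_lt_inv₀ (N.rate_pos hn t)).2 (N.rate_lt_one hn t))

theorem le_iff_mul_windowBound_le_one (hn : 2 ≤ n) (hT : 1 ≤ T)
    (hv : N.IsConnectivityEigenvector v) {m : ℕ} {β : ℝ}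
    (hβ : Real.log β = ∑ k ∈ Finset.Icc 1 m, Real.log (1 - N.decrease v k / N.rate 0)) :
    Real.log (T * √n) / Real.log (N.rate 0)⁻¹ - Real.log β⁻¹ / Real.log (N.rate 0)⁻¹ ≤ (m + 1 : ℕ)
      ↔ T * √n * N.windowBound v (m + 1) ≤ 1 := by
  have hTn : (0 : ℝ) < T * √n := by positivity
  have hW := windowBound_pos hn hv (m + 1)
  rw [← sub_div, div_le_iff₀ (log_inv_rate_pos hn 0), ← Real.log_nonpos_iff (by positivity),
    Real.log_mul hTn.ne' hW.ne', log_windowBound hn hv m, Real.log_inv, Real.log_inv, hβ]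
  constructor <;> intro h <;> linarith

theorem exists_feasible_iff (hn : 2 ≤ n) (hT : 1 ≤ T) (hv : N.IsConnectivityEigenvector v) (δ : ℕ) :
    (∃ β, N.Feasible v β δ) ↔ 1 ≤ δ ∧ T * √n * N.windowBound v δ ≤ 1 := by
  simp only [Feasible, sigma2_P_zero hn hv, ge_iff_le]
  constructor
  · rintro ⟨β, -, hδ, hβ, hle⟩
    obtain ⟨m, rfl⟩ := Nat.exists_eq_add_of_le' hδ
    exact ⟨hδ, (le_iff_mul_windowBound_le_one hn hT hv hβ).1 hle⟩
  · rintro ⟨hδ, hle⟩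
    obtain ⟨m, rfl⟩ := Nat.exists_eq_add_of_le' hδ
    have hβ := Real.log_exp (∑ k ∈ Finset.Icc 1 m, Real.log (1 - N.decrease v k / N.rate 0))
    exact ⟨_, Real.exp_pos _, hδ, hβ, (le_iff_mul_windowBound_le_one hn hT hv hβ).2 hle⟩

theorem mul_windowBound_ceil_le_one (hn : 2 ≤ n) (hv : N.IsConnectivityEigenvector v) {a : ℝ}
    (ha : 0 < a) : a * N.windowBound v ⌈Real.log a / Real.log (N.rate 0)⁻¹⌉₊ ≤ 1 := by
  set d := ⌈Real.log a / Real.log (N.rate 0)⁻¹⌉₊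
  have hs := N.rate_pos hn 0
  have hd : Real.log a ≤ d * Real.log (N.rate 0)⁻¹ :=
    (div_le_iff₀ (log_inv_rate_pos hn 0)).1 (Nat.le_ceil _)
  calc a * N.windowBound v d ≤ a * N.rate 0 ^ d := by
        gcongr
        exact windowBound_le_pow hn hv d
    _ ≤ 1 := by
        rw [← Real.log_nonpos_iff (by positivity), Real.log_mul (by positivity) (by positivity),
          Real.log_pow]
        rw [Real.log_inv] at hd
        linarith

theorem exists_isMixingTime (hn : 2 ≤ n) (hT : 1 ≤ T) (hv : N.IsConnectivityEigenvector v) :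
    ∃ δ, N.IsMixingTime v δ ∧ δ ≤ ⌈Real.log (T * √n) / Real.log (sigma2 (N.P 0))⁻¹⌉₊ := by
  have hn1 : 1 < √n := (Real.lt_sqrt zero_le_one).2 (by rw [one_pow]; exact_mod_cast hn)
  have hTn : 1 < T * √n := one_lt_mul_of_le_of_lt (by exact_mod_cast hT) hn1
  rw [sigma2_P_zero hn hv]
  have hmem := (exists_feasible_iff hn hT hv _).2
    ⟨Nat.ceil_pos.2 (div_pos (Real.log_pos hTn) (log_inv_rate_pos hn 0)),
      mul_windowBound_ceil_le_one hn hv (zero_lt_one.trans hTn)⟩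
  exact ⟨sInf {d | ∃ β, N.Feasible v β d}, ⟨Nat.sInf_mem ⟨_, hmem⟩, fun _ hd => Nat.sInf_le hd⟩,
    Nat.sInf_le hmem⟩

theorem le_two_pow_of_mul_windowBound_le_one (hn : 2 ≤ n) (hv : N.IsConnectivityEigenvector v)
    {δ : ℕ} (hδ : T * √n * N.windowBound v δ ≤ 1) : T ≤ 2 ^ δ := by
  have hn1 : 1 ≤ √n := Real.one_le_sqrt.2 (by exact_mod_cast one_le_two.trans hn)
  have hpow : (T : ℝ) / 2 ^ δ ≤ 1 :=
    calc (T : ℝ) / 2 ^ δ = T * 1 * (1 / 2) ^ δ := by rw [one_div_pow, mul_one, mul_one_div]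
      _ ≤ T * √n * N.windowBound v δ := by
        gcongr
        exact half_pow_le_windowBound hn hv δ
      _ ≤ 1 := hδ
  rw [div_le_one (by positivity)] at hpow
  exact_mod_cast hpow

end EvolvingNetwork

section DualAveraging

variable {E : Type*} [NormedAddCommGroup E] [NormedSpace ℝ E] {X : Set E}

theorem quadratic_growth_of_isMinOn {h : E → ℝ} {m : ℝ} {x y : E} (hh : StrongConvexOn X m h)
    (hy : y ∈ X) (hmin : IsMinOn h X y) (hx : x ∈ X) : h y + m / 2 * ‖x - y‖ ^ 2 ≤ h x := by
  have hseg : ∀ a ∈ Set.Ioo (0 : ℝ) 1, h y + (1 - a) * (m / 2 * ‖x - y‖ ^ 2) ≤ h x := by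
    rintro a ⟨ha, ha1⟩
    have hconv := hh.2 hx hy ha.le (sub_nonneg.2 ha1.le) (add_sub_cancel a 1)
    have hle := (hmin (hh.1 hx hy ha.le (sub_nonneg.2 ha1.le) (add_sub_cancel a 1))).trans hconv
    simp only [smul_eq_mul] at hle
    refine le_of_mul_le_mul_left ?_ ha
    linarith
  have hlim : Filter.Tendsto (fun a : ℝ => h y + (1 - a) * (m / 2 * ‖x - y‖ ^ 2))
      (nhdsWithin 0 (Set.Ioi 0)) (nhds (h y + (1 - 0) * (m / 2 * ‖x - y‖ ^ 2))) :=
    (Continuous.tendsto (by fun_prop) 0).mono_left nhdsWithin_le_nhds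
  rw [sub_zero, one_mul] at hlim
  exact le_of_tendsto hlim
    (Filter.mem_of_superset (Ioo_mem_nhdsGT zero_lt_one) hseg)

theorem neg_norm_mul_le_apply (g : StrongDual ℝ E) (x : E) : -(‖g‖ * ‖x‖) ≤ g x :=
  neg_le_of_abs_le (g.le_opNorm x)

theorem apply_le_norm_mul (g : StrongDual ℝ E) (x : E) : g x ≤ ‖g‖ * ‖x‖ :=
  le_of_abs_le (g.le_opNorm x)

/-- The regularized linear objective `z(y) + ψ(y) / a`, which the primal step of dual averaging
minimizes. -/
noncomputable def proxObj (ψ : E → ℝ) (a : ℝ) (z : StrongDual ℝ E) (y : E) : ℝ :=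
  z y + 1 / a * ψ y

/-- `ψ` is a proximal function on `X`: nonnegative, `1`-strongly convex on `X`, and zero at the
origin, which lies in `X`. -/
structure IsProxFunction (X : Set E) (ψ : E → ℝ) : Prop where
  zero_mem : (0 : E) ∈ X
  strongConvexOn : StrongConvexOn X 1 ψ
  nonneg : ∀ x ∈ X, 0 ≤ ψ x
  zero : ψ 0 = 0

namespace IsProxFunction

variable {ψ : E → ℝ} (hX : IsProxFunction X ψ)

include hX

theorem isMinOn_zero : IsMinOn ψ X 0 := fun x hx =>
  hX.zero.trans_le (hX.nonneg x hx)

theorem half_sq_norm_le {x : E} (hx : x ∈ X) : ‖x‖ ^ 2 / 2 ≤ ψ x := by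
  have h := quadratic_growth_of_isMinOn hX.strongConvexOn hX.zero_mem hX.isMinOn_zero hx
  rw [hX.zero, sub_zero] at h
  linarith

theorem norm_le_two_mul {x : E} {R : ℝ} (hx : x ∈ X) (hR : 0 ≤ R) (hψ : ψ x ≤ R ^ 2) :
    ‖x‖ ≤ 2 * R := by
  refine le_of_sq_le_sq ?_ (by positivity)
  nlinarith [hX.half_sq_norm_le hx]

theorem strongConvexOn_proxObj {a : ℝ} (ha : 0 < a) (z : StrongDual ℝ E) :
    StrongConvexOn X (1 / a) (proxObj ψ a z) := by
  refine ⟨hX.strongConvexOn.1, fun x hx y hy p q hp hq hpq => ?_⟩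
  have h := mul_le_mul_of_nonneg_left (hX.strongConvexOn.2 hx hy hp hq hpq) (one_div_pos.2 ha).le
  simp only [proxObj, map_add, map_smul, smul_eq_mul] at h ⊢
  linarith

theorem proxObj_add_sq_le {a : ℝ} (ha : 0 < a) {z : StrongDual ℝ E} {x y : E} (hy : y ∈ X)
    (hmin : IsMinOn (proxObj ψ a z) X y) (hx : x ∈ X) :
    proxObj ψ a z y + ‖x - y‖ ^ 2 / (2 * a) ≤ proxObj ψ a z x := by
  have h := quadratic_growth_of_isMinOn (hX.strongConvexOn_proxObj ha z) hy hmin hx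
  rwa [div_div, mul_comm a 2, one_div_mul_eq_div] at h

theorem proxObj_anti {a a' : ℝ} (ha' : 0 < a') (haa' : a' ≤ a) (z : StrongDual ℝ E) {x : E}
    (hx : x ∈ X) : proxObj ψ a z x ≤ proxObj ψ a' z x := by
  have := hX.nonneg x hx
  unfold proxObj
  gcongr

theorem norm_sub_le {a : ℝ} (ha : 0 < a) {z z' : StrongDual ℝ E} {y y' : E} (hy : y ∈ X)
    (hmin : IsMinOn (proxObj ψ a z) X y) (hy' : y' ∈ X) (hmin' : IsMinOn (proxObj ψ a z') X y') :
    ‖y - y'‖ ≤ a * ‖z - z'‖ := by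
  have hgrowth := hX.proxObj_add_sq_le ha hy hmin hy'
  have hgrowth' := hX.proxObj_add_sq_le ha hy' hmin' hy
  have hdual : (z - z') (y' - y) ≤ ‖z - z'‖ * ‖y' - y‖ := apply_le_norm_mul _ _
  rw [norm_sub_rev y' y] at hgrowth hdual
  simp only [proxObj, map_sub, sub_apply] at hgrowth hgrowth' hdual
  have hsq : ‖y - y'‖ * ‖y - y'‖ ≤ a * ‖z - z'‖ * ‖y - y'‖ := by
    have h : ‖y - y'‖ ^ 2 / (2 * a) ≤ ‖z - z'‖ * ‖y - y'‖ / 2 := by linarith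
    rw [div_le_iff₀ (by positivity)] at h
    linarith
  rcases (norm_nonneg (y - y')).eq_or_lt with h0 | h0
  · rw [← h0]
    positivity
  · exact le_of_mul_le_mul_right hsq h0

end IsProxFunction

end DualAveraging

section Regret

theorem exists_weight_neg_le {a G U : ℝ} (ha : 0 < a) (hG : 0 ≤ G) (hU : 0 ≤ U) :
    ∃ θ ∈ Set.Icc (0 : ℝ) 1, ∀ r : ℝ,
      -(a / 2 * G ^ 2 + a * G * U) ≤ θ * (2 - θ) * (r ^ 2 / (2 * a)) - (G + θ * U) * r := by
  rcases hG.eq_or_lt with rfl | hG'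
  · exact ⟨0, Set.left_mem_Icc.2 zero_le_one, fun r => by simp⟩
  refine ⟨G / (G + U), ⟨by positivity, div_le_one_of_le₀ (by linarith) (by positivity)⟩,
    fun r => ?_⟩
  have hsq : G / (G + U) * (2 - G / (G + U)) * (r ^ 2 / (2 * a)) - (G + G / (G + U) * U) * r
      + (a / 2 * G ^ 2 + a * G * U) = G * (G + 2 * U) / (2 * a) * (r / (G + U) - a) ^ 2 := by
    field_simp
    ring
  have : 0 ≤ G * (G + 2 * U) / (2 * a) * (r / (G + U) - a) ^ 2 := by positivity
  linarith

theorem half_mul_sq_le {a G L : ℝ} (ha : 0 ≤ a) (hG : 0 ≤ G) (hGL : G ≤ L) :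
    a / 2 * G ^ 2 ≤ L ^ 2 / 2 * a :=
  calc a / 2 * G ^ 2 ≤ a / 2 * L ^ 2 := by gcongr
    _ = L ^ 2 / 2 * a := by ring

namespace IsProxFunction

variable {E : Type*} [NormedAddCommGroup E] [NormedSpace ℝ E] {X : Set E} {ψ : E → ℝ}
  (hX : IsProxFunction X ψ)

include hX

theorem add_le_proxObj_of_forall_le {a c : ℝ} (ha : 0 < a) {z ζ : StrongDual ℝ E} {x y : E}
    (hc : ∀ p ∈ X, c ≤ proxObj ψ a z p) (hy : y ∈ X) (hmin : IsMinOn (proxObj ψ a ζ) X y)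
    (hx : x ∈ X) {θ : ℝ} (hθ : θ ∈ Set.Icc (0 : ℝ) 1) :
    c + θ * (2 - θ) * (‖x - y‖ ^ 2 / (2 * a)) - θ * ‖z - ζ‖ * ‖x - y‖ ≤ proxObj ψ a z x := by
  obtain ⟨hθ0, hθ1⟩ := hθ
  have hconv := hX.strongConvexOn_proxObj ha z
  have hsum : 1 - θ + θ = 1 := sub_add_cancel 1 θ
  have hmix := (hc _ (hconv.1 hx hy (sub_nonneg.2 hθ1) hθ0 hsum)).trans
    (hconv.2 hx hy (sub_nonneg.2 hθ1) hθ0 hsum)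
  have hgap : ‖x - y‖ ^ 2 / (2 * a) - ‖z - ζ‖ * ‖x - y‖ ≤ proxObj ψ a z x - proxObj ψ a z y := by
    have hgrowth := hX.proxObj_add_sq_le ha hy hmin hx
    have hdual := neg_norm_mul_le_apply (z - ζ) (x - y)
    simp only [proxObj, map_sub, sub_apply] at hgrowth hdual ⊢
    linarith
  simp only [smul_eq_mul, div_div, mul_comm a 2, one_div_mul_eq_div] at hmix
  linarith [mul_le_mul_of_nonneg_left hgap hθ0]

-- The minimum of `proxObj ψ a z` may not be attained, so it is bounded below along the segment
-- from `x` to the minimizer `y` for the nearby dual point `ζ`.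
theorem add_apply_sub_le_proxObj_add {a c : ℝ} (ha : 0 < a) {z ζ : StrongDual ℝ E} {x y : E}
    (hc : ∀ p ∈ X, c ≤ proxObj ψ a z p) (hy : y ∈ X) (hmin : IsMinOn (proxObj ψ a ζ) X y)
    (g : StrongDual ℝ E) (hx : x ∈ X) :
    c + g y - a / 2 * ‖g‖ ^ 2 - a * ‖g‖ * ‖z - ζ‖ ≤ proxObj ψ a (z + g) x := by
  obtain ⟨θ, hθ, hr⟩ := exists_weight_neg_le ha (norm_nonneg g) (norm_nonneg (z - ζ))
  have hseg := hX.add_le_proxObj_of_forall_le ha hc hy hmin hx hθ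
  have hdual := neg_norm_mul_le_apply g (x - y)
  rw [map_sub] at hdual
  rw [proxObj, add_apply]
  rw [proxObj] at hseg
  linarith [hr ‖x - y‖]

theorem neg_half_mul_sq_le_proxObj {a : ℝ} (ha : 0 < a) (z : StrongDual ℝ E) {x : E} (hx : x ∈ X) :
    -(a / 2 * ‖z‖ ^ 2) ≤ proxObj ψ a z x := by
  have hnonneg : ∀ p ∈ X, 0 ≤ proxObj ψ a 0 p := fun p hp => by
    have := hX.nonneg p hp
    rw [proxObj, zero_apply, zero_add]
    positivity
  have hmin : IsMinOn (proxObj ψ a 0) X 0 := fun p hp => by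
    simpa [proxObj, hX.zero] using hnonneg p hp
  simpa using hX.add_apply_sub_le_proxObj_add ha hnonneg hX.zero_mem hmin z hx

variable {a : ℕ → ℝ} {L B : ℝ} {T : ℕ} {g ζ : ℕ → StrongDual ℝ E} {y : ℕ → E}

theorem sum_apply_sub_le_proxObj (ha : ∀ t, 0 < a t) (hanti : Antitone a)
    (hg : ∀ t ≤ T, ‖g t‖ ≤ L) (hy : ∀ t < T, y t ∈ X)
    (hmin : ∀ t < T, IsMinOn (proxObj ψ (a t) (ζ t)) X (y t))
    (hB : ∀ t < T, ‖∑ r ∈ Finset.range (t + 1), g r - ζ t‖ ≤ B) {x : E} (hx : x ∈ X) :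
    ∑ t ∈ Finset.range T, g (t + 1) (y t) - L ^ 2 / 2 * (a 0 + ∑ t ∈ Finset.range T, a t)
        - L * B * ∑ t ∈ Finset.range T, a t
      ≤ proxObj ψ (a T) (∑ r ∈ Finset.range (T + 1), g r) x := by
  induction T generalizing x with
  | zero =>
    have h := hX.neg_half_mul_sq_le_proxObj (ha 0) (g 0) hx
    simp only [zero_add, Finset.sum_range_one, Finset.sum_range_zero, add_zero, mul_zero]
    linarith [half_mul_sq_le (ha 0).le (norm_nonneg _) (hg 0 le_rfl)]
  | succ k ih =>
    have hih : ∀ p ∈ X, _ ≤ proxObj ψ (a k) _ p := fun p hp =>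
      ih (fun t ht => hg t (by lia)) (fun t ht => hy t (by lia)) (fun t ht => hmin t (by lia))
        (fun t ht => hB t (by lia)) hp
    have hstep := hX.add_apply_sub_le_proxObj_add (ha k) hih (hy k k.lt_succ_self)
      (hmin k k.lt_succ_self) (g (k + 1)) hx
    have hanti' := hX.proxObj_anti (ha (k + 1)) (hanti k.le_succ)
      (∑ r ∈ Finset.range (k + 1 + 1), g r) hx
    have herror : a k * ‖g (k + 1)‖ * ‖∑ r ∈ Finset.range (k + 1), g r - ζ k‖ ≤ a k * L * B := by
      have hL : 0 ≤ L := (norm_nonneg _).trans (hg _ le_rfl)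
      have := (ha k).le
      gcongr
      · exact hg _ le_rfl
      · exact hB k k.lt_succ_self
    rw [Finset.sum_range_succ _ (k + 1)] at hanti' ⊢
    rw [Finset.sum_range_succ, Finset.sum_range_succ]
    linarith [half_mul_sq_le (ha k).le (norm_nonneg _) (hg (k + 1) le_rfl)]

-- The primal step of time `t` precedes the input `g (t + 1)`, so `g 0` is not charged as regret.
theorem regret_le {R : ℝ} (hR : 0 ≤ R) (ha : ∀ t, 0 < a t) (hanti : Antitone a)
    (hg : ∀ t ≤ T, ‖g t‖ ≤ L) (hy : ∀ t < T, y t ∈ X)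
    (hmin : ∀ t < T, IsMinOn (proxObj ψ (a t) (ζ t)) X (y t))
    (hB : ∀ t < T, ‖∑ r ∈ Finset.range (t + 1), g r - ζ t‖ ≤ B)
    {xs : E} (hxs : xs ∈ X) (hψ : ψ xs ≤ R ^ 2) :
    ∑ t ∈ Finset.range T, g (t + 1) (y t - xs)
      ≤ R ^ 2 / a T + 2 * L * R + L ^ 2 / 2 * (a 0 + ∑ t ∈ Finset.range T, a t)
        + L * B * ∑ t ∈ Finset.range T, a t := by
  have hlower := hX.sum_apply_sub_le_proxObj ha hanti hg hy hmin hB hxs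
  have hL : 0 ≤ L := (norm_nonneg _).trans (hg 0 T.zero_le)
  have hfirst : g 0 xs ≤ 2 * L * R :=
    calc g 0 xs ≤ ‖g 0‖ * ‖xs‖ := apply_le_norm_mul _ _
      _ ≤ L * (2 * R) :=
        mul_le_mul (hg 0 T.zero_le) (hX.norm_le_two_mul hxs hR hψ) (norm_nonneg _) hL
      _ = 2 * L * R := by ring
  have hprox : 1 / a T * ψ xs ≤ R ^ 2 / a T := by
    rw [one_div_mul_eq_div]
    exact div_le_div_of_nonneg_right hψ (ha T).le
  rw [proxObj, sum_apply, Finset.sum_range_succ'] at hlower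
  simp only [map_sub, Finset.sum_sub_distrib]
  linarith

end IsProxFunction

end Regret

section NetworkCost

variable {E : Type*} [NormedAddCommGroup E] [NormedSpace ℝ E] {n : ℕ} {X : Set E}
  {f : Fin n → E → ℝ}

theorem convexOn_networkCost (hX : Convex ℝ X) (hf : ∀ i, ConvexOn ℝ X (f i)) :
    ConvexOn ℝ X (networkCost f) := by
  refine ⟨hX, fun x hx y hy a b ha hb hab => ?_⟩
  have hsum : ∑ i, f i (a • x + b • y) ≤ a * ∑ i, f i x + b * ∑ i, f i y := by
    rw [Finset.mul_sum, Finset.mul_sum, ← Finset.sum_add_distrib]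
    exact Finset.sum_le_sum fun i _ => (hf i).2 hx hy ha hb hab
  simp only [networkCost, smul_eq_mul]
  linarith [mul_le_mul_of_nonneg_left hsum (by positivity : (0 : ℝ) ≤ 1 / n)]

theorem runningAverage_eq_sum_range (x : ℕ → Fin n → E) (T : ℕ) (i : Fin n) :
    runningAverage x T i = ∑ t ∈ Finset.range T, (1 / (T : ℝ)) • x (t + 1) i := by
  rw [runningAverage, Finset.smul_sum, Finset.range_eq_Ico,
    Finset.sum_Ico_add' (fun t => (1 / (T : ℝ)) • x t i), zero_add,
    Finset.Ico_add_one_right_eq_Icc]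

theorem networkCost_runningAverage_le (hX : Convex ℝ X) (hf : ∀ i, ConvexOn ℝ X (f i)) {T : ℕ}
    (hT : T ≠ 0) {x : ℕ → Fin n → E} {i : Fin n} (hx : ∀ t < T, x (t + 1) i ∈ X) :
    networkCost f (runningAverage x T i)
      ≤ 1 / T * ∑ t ∈ Finset.range T, networkCost f (x (t + 1) i) := by
  rw [runningAverage_eq_sum_range, Finset.mul_sum]
  refine (convexOn_networkCost hX hf).map_sum_le (fun _ _ => by positivity) ?_
    fun t ht => hx t (Finset.mem_range.1 ht)
  simp [hT]

theorem networkCost_sub_le {L D : ℝ}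
    (hf : ∀ i, ∀ x ∈ X, ∀ y ∈ X, |f i x - f i y| ≤ L * ‖x - y‖) {x : Fin n → E}
    (hx : ∀ i, x i ∈ X) {g : Fin n → StrongDual ℝ E} (hg : ∀ i, ‖g i‖ ≤ L) {xs : E}
    (hsub : ∀ i, f i (x i) + g i (xs - x i) ≤ f i xs) {i : Fin n} (hD : ∀ j, ‖x i - x j‖ ≤ D) :
    networkCost f (x i) - networkCost f xs ≤ nodeAverage g (x i - xs) + 2 * L * D := by
  have hn : (n : ℝ) ≠ 0 := by exact_mod_cast i.pos.ne'
  have hL : 0 ≤ L := (norm_nonneg _).trans (hg i)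
  have hterm : ∀ j, f j (x i) - f j xs ≤ g j (x i - xs) + 2 * L * D := by
    intro j
    have hlip := le_of_abs_le (hf j _ (hx i) _ (hx j))
    have hdual := neg_norm_mul_le_apply (g j) (x i - x j)
    have hLD : L * ‖x i - x j‖ ≤ L * D := mul_le_mul_of_nonneg_left (hD j) hL
    have hgD : ‖g j‖ * ‖x i - x j‖ ≤ L * D := mul_le_mul (hg j) (hD j) (norm_nonneg _) hL
    have hsubj := hsub j
    simp only [map_sub] at hdual hsubj ⊢
    linarith
  calc networkCost f (x i) - networkCost f xs = 1 / n * ∑ j, (f j (x i) - f j xs) := by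
        rw [networkCost, networkCost, ← mul_sub, Finset.sum_sub_distrib]
    _ ≤ 1 / n * ∑ j, (g j (x i - xs) + 2 * L * D) := by
        gcongr
        exact hterm _
    _ = nodeAverage g (x i - xs) + 2 * L * D := by
        rw [nodeAverage, smul_apply, sum_apply, smul_eq_mul, Finset.sum_add_distrib, mul_add,
          Finset.sum_const, Finset.card_univ, nsmul_eq_mul, Fintype.card_fin,
          one_div, inv_mul_cancel_left₀ hn]

variable {L R B : ℝ} {ψ : E → ℝ} {T : ℕ} {P : ℕ → Matrix (Fin n) (Fin n) ℝ} {α : ℕ → ℝ}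
  {x : ℕ → Fin n → E} {z g : ℕ → Fin n → StrongDual ℝ E}

theorem IsDDARun.norm_sub_le (hrun : IsDDARun P X f L ψ α T x z g) (hX : IsProxFunction X ψ)
    (hα : ∀ t, 0 < α t) {w : StrongDual ℝ E} {t : ℕ} (ht : t < T)
    (hB : ∀ i, ‖z (t + 1) i - w‖ ≤ B) (i j : Fin n) :
    ‖x (t + 1) i - x (t + 1) j‖ ≤ 2 * (α t * B) := by
  have hdual : ‖z (t + 1) i - z (t + 1) j‖ ≤ 2 * B := by
    have := norm_sub_le_norm_sub_add_norm_sub (z (t + 1) i) w (z (t + 1) j)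
    rw [norm_sub_rev w] at this
    linarith [hB i, hB j]
  calc ‖x (t + 1) i - x (t + 1) j‖ ≤ α t * ‖z (t + 1) i - z (t + 1) j‖ :=
        hX.norm_sub_le (hα t) (hrun.x_mem t ht i) (hrun.x_step t ht i) (hrun.x_mem t ht j)
          (hrun.x_step t ht j)
    _ ≤ α t * (2 * B) := mul_le_mul_of_nonneg_left hdual (hα t).le
    _ = 2 * (α t * B) := by ring

theorem IsDDARun.networkCost_sub_le (hrun : IsDDARun P X f L ψ α T x z g)
    (hX : IsProxFunction X ψ) (hconv : ∀ i, ConvexOn ℝ X (f i))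
    (hlip : ∀ i, ∀ x ∈ X, ∀ y ∈ X, |f i x - f i y| ≤ L * ‖x - y‖) (hT : T ≠ 0) (hR : 0 ≤ R)
    {xs : E} (hxs : xs ∈ X) (hψ : ψ xs ≤ R ^ 2) (hα : ∀ t, 0 < α t) (hanti : Antitone α)
    (hB : ∀ t ≤ T, ∀ i, ‖z t i - ∑ r ∈ Finset.range t, nodeAverage (g r)‖ ≤ B) (i : Fin n) :
    networkCost f (runningAverage x T i) - networkCost f xs
      ≤ 1 / T * (R ^ 2 / α T + 2 * L * R + L ^ 2 / 2 * (α 0 + ∑ t ∈ Finset.range T, α t)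
        + 5 * L * B * ∑ t ∈ Finset.range T, α t) := by
  have : Nonempty (Fin n) := ⟨i⟩
  have hT0 : (T : ℝ) ≠ 0 := Nat.cast_ne_zero.2 hT
  have hregret := hX.regret_le hR hα hanti
    (fun t ht => norm_nodeAverage_le (hrun.subgradient_norm t ht))
    (fun t ht => hrun.x_mem t ht i) (fun t ht => hrun.x_step t ht i)
    (fun t ht => (norm_sub_rev _ _).trans_le (hB (t + 1) ht i)) hxs hψ
  have hstep : ∀ t ∈ Finset.range T, networkCost f (x (t + 1) i) - networkCost f xs
      ≤ nodeAverage (g (t + 1)) (x (t + 1) i - xs) + 4 * L * B * α t := by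
    intro t ht
    rw [Finset.mem_range] at ht
    refine (_root_.networkCost_sub_le hlip (hrun.x_mem t ht) (hrun.subgradient_norm (t + 1) ht)
      (fun j => hrun.subgradient (t + 1) ht j xs hxs)
      (hrun.norm_sub_le hX hα ht (hB (t + 1) ht) i)).trans_eq ?_
    ring
  have hsum := Finset.sum_le_sum hstep
  rw [Finset.sum_add_distrib, ← Finset.mul_sum] at hsum
  calc networkCost f (runningAverage x T i) - networkCost f xs
      ≤ 1 / T * ∑ t ∈ Finset.range T, networkCost f (x (t + 1) i) - networkCost f xs :=
        sub_le_sub_right (networkCost_runningAverage_le hX.strongConvexOn.1 hconv hT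
          fun t ht => hrun.x_mem t ht i) _
    _ = 1 / T * ∑ t ∈ Finset.range T, (networkCost f (x (t + 1) i) - networkCost f xs) := by
        rw [Finset.sum_sub_distrib, Finset.sum_const, Finset.card_range, nsmul_eq_mul, mul_sub,
          one_div, inv_mul_cancel_left₀ hT0]
    _ ≤ _ := by
        gcongr
        linarith

end NetworkCost

section StepSizes

theorem one_div_sqrt_le_three_mul_sub {s : ℝ} (hs : 1 ≤ s) : 1 / √s ≤ 3 * (√(s + 1) - √s) := by
  have hs0 : 0 ≤ s := zero_le_one.trans hs
  have hsq := Real.sq_sqrt hs0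
  have hsq' := Real.sq_sqrt (by linarith : 0 ≤ s + 1)
  have hle : √(s + 1) ≤ 2 * √s := Real.sqrt_le_iff.2 ⟨by positivity, by linarith [mul_pow 2 √s 2]⟩
  have hdiff : (√(s + 1) - √s) * (√(s + 1) + √s) = 1 := by linarith
  have hdiff0 : 0 ≤ √(s + 1) - √s := sub_nonneg.2 (Real.sqrt_le_sqrt (by linarith))
  rw [div_le_iff₀ (Real.sqrt_pos.2 (zero_lt_one.trans_le hs))]
  linarith [hdiff, mul_le_mul_of_nonneg_left hle hdiff0]

variable {α : ℕ → ℝ} {A : ℝ}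

theorem antitone_of_eq_div_sqrt (hA : 0 ≤ A) (h0 : α 0 = A) (hα : ∀ t : ℕ, 1 ≤ t → α t = A / √t) :
    Antitone α := by
  refine antitone_nat_of_succ_le fun t => ?_
  rcases t.eq_zero_or_pos with rfl | ht
  · simp [hα 1 le_rfl, h0]
  · rw [hα t ht, hα (t + 1) t.succ_pos]
    gcongr
    exact t.le_succ

theorem pos_of_eq_div_sqrt (hA : 0 < A) (h0 : α 0 = A) (hα : ∀ t : ℕ, 1 ≤ t → α t = A / √t)
    (t : ℕ) : 0 < α t := by
  rcases t.eq_zero_or_pos with rfl | ht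
  · exact h0 ▸ hA
  · rw [hα t ht]
    positivity

theorem sum_range_le_three_mul_sqrt (hA : 0 ≤ A) (h0 : α 0 = A)
    (hα : ∀ t : ℕ, 1 ≤ t → α t = A / √t) (T : ℕ) : ∑ t ∈ Finset.range T, α t ≤ 3 * A * √T := by
  induction T with
  | zero => simp
  | succ T ih =>
    rw [Finset.sum_range_succ, Nat.cast_succ]
    rcases T.eq_zero_or_pos with rfl | hT
    · simp only [Finset.sum_range_zero, h0, Nat.cast_zero, zero_add, Real.sqrt_one]
      linarith
    · have hstep := mul_le_mul_of_nonneg_left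
        (one_div_sqrt_le_three_mul_sub (s := T) (by exact_mod_cast hT)) hA
      rw [mul_one_div, ← hα T hT] at hstep
      linarith

end StepSizes

section FinalBound

theorem dualAveraging_bound_le {c L R q δ s A S : ℝ} (hc : 0 < c) (hL : 0 < L) (hR : 0 < R)
    (hq : 0 < q) (hδ : 1 ≤ δ) (hs : 1 ≤ s) (hA : A = c * R * q / L) (hS : S ≤ 3 * A * s) :
    1 / s ^ 2 * (R ^ 2 / (A / s) + 2 * L * R + L ^ 2 / 2 * (A + S)
        + 5 * L * ((2 * δ + 1) * L) * S)
      ≤ R * L / s * (1 / (c * q) + 2 + 47 * c * q * δ) := by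
  have : 0 < s := zero_lt_one.trans_le hs
  have hA0 : 0 < A := hA ▸ by positivity
  have hprox : R ^ 2 / (A / s) = R * L * s * (1 / (c * q)) := by
    rw [hA]
    field_simp
  have hfirst : 2 * L * R ≤ R * L * s * 2 := by
    linarith [mul_le_mul_of_nonneg_left hs (by positivity : 0 ≤ R * L)]
  have hregret : A + S ≤ 4 * A * s * δ := by
    have hAs : A ≤ A * s := le_mul_of_one_le_right hA0.le hs
    have hAsδ : A * s ≤ A * s * δ := le_mul_of_one_le_right (by positivity) hδ
    linarith
  have hconsensus : (2 * δ + 1) * S ≤ 9 * A * s * δ :=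
    calc (2 * δ + 1) * S ≤ (2 * δ + 1) * (3 * A * s) := by gcongr
      _ ≤ 3 * δ * (3 * A * s) := by
          gcongr
          linarith
      _ = 9 * A * s * δ := by ring
  have hLA : L ^ 2 * A = R * L * (c * q) := by
    rw [hA]
    field_simp
  calc _ ≤ 1 / s ^ 2 * (R * L * s * (1 / (c * q)) + R * L * s * 2 + L ^ 2 / 2 * (4 * A * s * δ)
          + 5 * L ^ 2 * (9 * A * s * δ)) := by
        have hmul := mul_le_mul_of_nonneg_left hconsensus (by positivity : 0 ≤ 5 * L ^ 2)
        rw [hprox]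
        gcongr 1 / s ^ 2 * (_ + ?_ + _ * ?_ + ?_)
        linarith
    _ = 1 / s ^ 2 * (R * L * s * (1 / (c * q) + 2) + L ^ 2 * A * (47 * s * δ)) := by ring
    _ = R * L / s * (1 / (c * q) + 2 + 47 * c * q * δ) := by
        rw [hLA]
        field_simp

theorem mul_bound_le_of_one_div_le {c L R p s δ M : ℝ} (hc : 0 < c) (hLR : 0 ≤ R * L / s)
    (hp : 0 < p) (hp1 : p ≤ 1) (hM : 1 / p ≤ M * δ) :
    R * L / s * (1 / (c * √p) + 2 + 47 * c * √p * δ)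
      ≤ ((1 / c + 2) * M + 47 * c) * (R * L * √p * δ / s) := by
  have hsqrt : 0 < √p := Real.sqrt_pos.2 hp
  have hinv : 1 / √p ≤ √p * (M * δ) :=
    calc 1 / √p = √p * (1 / p) := by rw [mul_one_div, Real.sqrt_div_self']
      _ ≤ √p * (M * δ) := by gcongr
  have hone : 1 ≤ 1 / √p := (one_le_div hsqrt).2 (Real.sqrt_le_one.2 hp1)
  calc R * L / s * (1 / (c * √p) + 2 + 47 * c * √p * δ)
      = R * L / s * (1 / c * (1 / √p) + 2 * 1 + 47 * c * √p * δ) := by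
        rw [one_div_mul_one_div, mul_one]
    _ ≤ R * L / s * (1 / c * (√p * (M * δ)) + 2 * (√p * (M * δ)) + 47 * c * √p * δ) := by
        gcongr
        exact hone.trans hinv
    _ = ((1 / c + 2) * M + 47 * c) * (R * L * √p * δ / s) := by ring

variable {n T : ℕ} {N : EvolvingNetwork n T} {v : ℕ → Fin n → ℝ} {E : Type*}
  [NormedAddCommGroup E] [NormedSpace ℝ E] {X : Set E} {f : Fin n → E → ℝ} {L : ℝ} {ψ : E → ℝ}
  {α : ℕ → ℝ} {x : ℕ → Fin n → E} {z g : ℕ → Fin n → StrongDual ℝ E}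

theorem IsDDARun.norm_sub_sum_nodeAverage_le (hrun : IsDDARun N.P X f L ψ α T x z g) (hn : 2 ≤ n)
    (hT : 1 ≤ T) (hv : N.IsConnectivityEigenvector v) {δ : ℕ}
    (hδ : T * √n * N.windowBound v δ ≤ 1) {t : ℕ} (ht : t ≤ T) (i : Fin n) :
    ‖z t i - ∑ r ∈ Finset.range t, nodeAverage (g r)‖ ≤ (2 * δ + 1) * L :=
  have hL : 0 ≤ L := (norm_nonneg _).trans (hrun.subgradient_norm 0 T.zero_le i)
  (_root_.norm_sub_sum_nodeAverage_le hrun.z_zero (fun s hs => hrun.z_step s (by lia))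
    (fun s hs => hrun.subgradient_norm s (by lia)) i).trans <|
    mul_le_mul_of_nonneg_right
      (EvolvingNetwork.sum_columnError_windowProd_le hn hT hv hδ ht i) hL

theorem IsDDARun.networkCost_sub_le_of_mul_windowBound_le_one
    (hrun : IsDDARun N.P X f L ψ α T x z g) (hn : 2 ≤ n) (hT : 1 ≤ T)
    (hv : N.IsConnectivityEigenvector v) (hX : IsProxFunction X ψ)
    (hconv : ∀ i, ConvexOn ℝ X (f i))
    (hlip : ∀ i, ∀ x ∈ X, ∀ y ∈ X, |f i x - f i y| ≤ L * ‖x - y‖) {c q R : ℝ} (hc : 0 < c)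
    (hL : 0 < L) (hR : 0 < R) (hq : 0 < q) {xs : E} (hxs : xs ∈ X) (hψ : ψ xs ≤ R ^ 2)
    (hα0 : α 0 = α 1) (hα : ∀ t : ℕ, 1 ≤ t → α t = c * (R * q / (L * √t)))
    {δ : ℕ} (hδ1 : 1 ≤ δ) (hδ : T * √n * N.windowBound v δ ≤ 1) (i : Fin n) :
    networkCost f (runningAverage x T i) - networkCost f xs
      ≤ R * L / √T * (1 / (c * q) + 2 + 47 * c * q * δ) := by
  obtain ⟨A, hA⟩ : ∃ A, A = c * R * q / L := ⟨_, rfl⟩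
  have hA0 : 0 < A := hA ▸ by positivity
  have hαA : ∀ t : ℕ, 1 ≤ t → α t = A / √t := fun t ht => by
    rw [hα t ht, hA]
    field_simp
  have h0 : α 0 = A := by rw [hα0, hαA 1 le_rfl, Nat.cast_one, Real.sqrt_one, div_one]
  have hbound := hrun.networkCost_sub_le hX hconv hlip (by lia) hR.le hxs hψ
    (pos_of_eq_div_sqrt hA0 h0 hαA) (antitone_of_eq_div_sqrt hA0.le h0 hαA)
    (fun t ht i => hrun.norm_sub_sum_nodeAverage_le hn hT hv hδ ht i) i
  rw [hαA T hT, h0, ← Real.sq_sqrt T.cast_nonneg] at hbound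
  rw [Real.sqrt_sq (Real.sqrt_nonneg _)] at hbound
  exact hbound.trans (dualAveraging_bound_le hc hL hR hq (by exact_mod_cast hδ1)
    (Real.one_le_sqrt.2 (by exact_mod_cast hT)) hA
    (sum_range_le_three_mul_sqrt hA0.le h0 hαA T))

theorem IsDistributedProblem.isProxFunction (hp : IsDistributedProblem X f L ψ) :
    IsProxFunction X ψ :=
  ⟨hp.zero_mem, hp.ψ_strongConvex, hp.ψ_nonneg, hp.ψ_zero⟩

end FinalBound

theorem theorem2_general (c : ℝ) (hc : 0 < c) :
    ∃ (C : ℝ) (T₀ : ℝ → ℕ) (K : ℝ → ℝ),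
      ∀ (n T : ℕ) (_ : 2 ≤ n) (_ : 1 ≤ T) (N : EvolvingNetwork n T) (v : ℕ → Fin n → ℝ)
        (_ : N.IsConnectivityEigenvector v)
        (E : Type*) [NormedAddCommGroup E] [NormedSpace ℝ E]
        (X : Set E) (f : Fin n → E → ℝ) (ψ : E → ℝ) (L R : ℝ) (_ : 0 < L) (_ : 0 < R)
        (_ : IsProxFunction X ψ) (_ : ∀ i, ConvexOn ℝ X (f i))
        (_ : ∀ i, ∀ x ∈ X, ∀ y ∈ X, |f i x - f i y| ≤ L * ‖x - y‖)
        (xs : E) (_ : xs ∈ X) (_ : ψ xs ≤ R ^ 2)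
        (α : ℕ → ℝ) (_ : α 0 = α 1)
        (_ : ∀ t : ℕ, 1 ≤ t → α t = c * (R * √(1 - sigma2 (N.P 0)) / (L * √t)))
        (x : ℕ → Fin n → E) (z g : ℕ → Fin n → StrongDual ℝ E)
        (_ : IsDDARun N.P X f L ψ α T x z g),
        ∃ δ : ℕ, N.IsMixingTime v δ ∧
          1 ≤ δ ∧ δ ≤ ⌈Real.log (T * √n) / Real.log (sigma2 (N.P 0))⁻¹⌉₊ ∧
          (∀ i, networkCost f (runningAverage x T i) - networkCost f xs ≤
            K (sigma2 (N.P 0)) * (R * L * √(1 - sigma2 (N.P 0)) * δ / √T)) ∧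
          (T₀ (sigma2 (N.P 0)) ≤ T →
            ∀ i, networkCost f (runningAverage x T i) - networkCost f xs ≤
              C * (R * L * √(1 - sigma2 (N.P 0)) * δ / √T)) := by
  refine ⟨(1 / c + 2) * 1 + 47 * c, fun s => 2 ^ ⌈1 / (1 - s)⌉₊,
    fun s => (1 / c + 2) * (1 / (1 - s)) + 47 * c, ?_⟩
  intro n T hn hT N v hv E _ _ X f ψ L R hL hR hX hconv hlip xs hxs hψ α hα0 hα x z g hrun
  obtain ⟨δ, hmix, hle⟩ := EvolvingNetwork.exists_isMixingTime hn hT hv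
  obtain ⟨hδ1, hδ⟩ := (EvolvingNetwork.exists_feasible_iff hn hT hv δ).1 hmix.1
  rw [EvolvingNetwork.sigma2_P_zero hn hv] at hα hle ⊢
  have hgap : 0 < 1 - N.rate 0 := sub_pos.2 (N.rate_lt_one hn 0)
  have hbound : ∀ M, 1 / (1 - N.rate 0) ≤ M * δ → ∀ i,
      networkCost f (runningAverage x T i) - networkCost f xs
        ≤ ((1 / c + 2) * M + 47 * c) * (R * L * √(1 - N.rate 0) * δ / √T) := fun M hM i =>
    (hrun.networkCost_sub_le_of_mul_windowBound_le_one hn hT hv hX hconv hlip hc hL hR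
      (Real.sqrt_pos.2 hgap) hxs hψ hα0 hα hδ1 hδ i).trans <|
      mul_bound_le_of_one_div_le hc (by positivity) hgap (sub_le_self 1 (N.rate_pos hn 0).le) hM
  refine ⟨δ, hmix, hδ1, hle, hbound _ ?_, fun hT₀ => hbound 1 ?_⟩
  · exact le_mul_of_one_le_right (by positivity) (by exact_mod_cast hδ1)
  · have hceil := (Nat.pow_le_pow_iff_right one_lt_two).1
      (hT₀.trans (EvolvingNetwork.le_two_pow_of_mul_windowBound_le_one hn hv hδ))
    rw [one_mul]
    exact Nat.ceil_le.1 hceil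

theorem theorem2 (c : ℝ) (hc : 0 < c) :
    ∃ (C : ℝ) (T₀ : ℝ → ℕ) (K : ℝ → ℝ),
      ∀ (n T : ℕ) (_ : 2 ≤ n) (_ : 1 ≤ T) (N : EvolvingNetwork n T) (v : ℕ → Fin n → ℝ)
        (_ : N.IsConnectivityEigenvector v)
        (E : Type*) [NormedAddCommGroup E] [NormedSpace ℝ E] [FiniteDimensional ℝ E]
        (X : Set E) (f : Fin n → E → ℝ) (ψ : E → ℝ) (L R : ℝ) (_ : 0 < L) (_ : 0 < R)
        (_ : IsDistributedProblem X f L ψ)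
        (xs : E) (_ : xs ∈ X) (_ : IsMinOn (networkCost f) X xs) (_ : ψ xs ≤ R ^ 2)
        (α : ℕ → ℝ) (_ : α 0 = α 1)
        (_ : ∀ t : ℕ, 1 ≤ t → α t = c * (R * √(1 - sigma2 (N.P 0)) / (L * √t)))
        (x : ℕ → Fin n → E) (z g : ℕ → Fin n → StrongDual ℝ E)
        (_ : IsDDARun N.P X f L ψ α T x z g),
        ∃ δ : ℕ, N.IsMixingTime v δ ∧
          1 ≤ δ ∧ δ ≤ ⌈Real.log (T * √n) / Real.log (sigma2 (N.P 0))⁻¹⌉₊ ∧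
          (∀ i, networkCost f (runningAverage x T i) - networkCost f xs ≤
            K (sigma2 (N.P 0)) * (R * L * √(1 - sigma2 (N.P 0)) * δ / √T)) ∧
          (T₀ (sigma2 (N.P 0)) ≤ T →
            ∀ i, networkCost f (runningAverage x T i) - networkCost f xs ≤
              C * (R * L * √(1 - sigma2 (N.P 0)) * δ / √T)) := by
  obtain ⟨C, T₀, K, h⟩ := theorem2_general c hc
  exact ⟨C, T₀, K, fun n T hn hT N v hv E _ _ _ X f ψ L R hL hR hp xs hxs _ =>
    h n T hn hT N v hv E X f ψ L R hL hR hp.isProxFunction hp.f_convex hp.f_lipschitz xs hxs⟩
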